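/- For every $n\ge 1$ let $\mathcal H_{A,n},\mathcal H_{B,n}$ be complex (finite- or infinite-dimensional separable) Hilbert spaces, let $\Phi_n\in\mathcal H_{A,n}\otimes\mathcal H_{B,n}$ be a unit vector, and let $\rho_n=\mathrm{Tr}_B|\Phi_n\rangle\langle\Phi_n|$. No relation between different $n$ is assumed. *Definitions.* A maximally entangled state of size $L\in\{1,2,\dots\}$ is a vector $\Psi=L^{-1/2}\sum_{k=1}^L e_k\otimes f_k$ with orthonormal systems $(e_k)$ and $(f_k)$. LOCC operations consist of finitely many rounds, in each of which one party measures its own system and announces the outcome; the output spaces are arbitrary. A deterministic concentration (DFLEC) is a pair $(C,\Psi)$ of an LOCC operation $C$ and a maximally entangled state $\Psi$ on its output space; its size $L(\Psi)$ is that of $\Psi$, and its fidelity is $\langle\Psi|C(\Phi)|\Psi\rangle$, where $C(\Phi)=C(|\Phi\rangle\langle\Phi|)$. A probabilistic concentration (PFLEC) of $\Phi$ is a two-valued LOCC instrument $I=\{I_0,I_1\}$ together with a maximally entangled state $\Psi$ such that $I_1(\Phi)=\mathrm{Tr}\,I_1(\Phi)\,|\Psi\rangle\langle\Psi|$ (no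 condition on $\Psi$ if $\mathrm{Tr}\,I_1(\Phi)=0$); its size $L(I)$ is that of $\Psi$. All limits are for $n\to\infty$, $\log 0=-\infty$, and suprema are taken in $[-\infty,\infty]$ with $\sup\emptyset=-\infty$. Put $$B_D(\epsilon)=\sup\{\varliminf\tfrac1n\log L(\Psi_n): \varliminf\langle\Psi_n|C^n(\Phi_n)|\Psi_n\rangle\ge1-\epsilon\},$$ $$B_{e,D}(r)=\sup\{\varliminf\tfrac1n\log L(\Psi_n): \varliminf\tfrac{-1}n\log(1-\langle\Psi_n|C^n(\Phi_n)|\Psi_n\rangle)\ge r\},$$ $$B^*_{e,D}(r)=\sup\{\varliminf\tfrac1n\log L(\Psi_n): \varlimsup\tfrac{-1}n\log\langle\Psi_n|C^n(\Phi_n)|\Psi_n\rangle\le r\},$$ the suprema being over all sequences of DFLECs $(C^n,\Psi_n)$, and $$B_P(\epsilon)=\sup\{\varliminf\tfrac1n\log L(I^n): \varlimsup\mathrm{Tr}\,I^n_0(\Phi_n)\le\epsilon\},$$ $$B_{e,P}(r)=\sup\{\varliminf\tfrac1n\log L(I^n): \varliminf\tfrac{-1}n\log\mathrm{Tr}\,I^n_0(\Phi_n)\ge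 r\},$$ $$B^*_{e,P}(r)=\sup\{\varliminf\tfrac1n\log L(I^n): \varlimsup\tfrac{-1}n\log\mathrm{Tr}\,I^n_1(\Phi_n)\le r\},$$ the suprema being over all sequences of PFLECs $I^n$ of $\Phi_n$. For real $a$ let $$K(a)=\varlimsup\mathrm{Tr}\,\rho_n\{\rho_n\ge e^{-na}\},\qquad \underline\zeta^c(a)=\varliminf\tfrac{-1}n\log\mathrm{Tr}\,\rho_n\{\rho_n>e^{-na}\},$$ where $\{\cdot\}$ denotes spectral projections, and, if it exists in $[0,\infty]$, let $\zeta(a)=\lim\tfrac{-1}n\log\mathrm{Tr}\,\rho_n\{\rho_n<e^{-na}\}$. **Theorem.** (i) For every $\epsilon\in[0,1]$ and every real $r$, $$B_D(\epsilon)=B_P(\epsilon)=\sup\{R\in\mathbb R: K(R)\le\epsilon\},\qquad B_{e,D}(r)=B_{e,P}(r)=\sup\{R\in\mathbb R:\underline\zeta^c(R)\ge r\}.$$ (ii) Assume that the limit $\zeta(a)$ exists in $[0,\infty]$ for every real $a$ and that $\zeta(a)\le\underline\zeta^c(a)$ for some real $a$. Then, with $H(a)=\inf_{a'\le a}\{\zeta(a')-\tfrac{a'}2\}$,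 for every real $r$, $$B^*_{e,D}(r)=\sup\{a-r: a\in\mathbb R,\ H(a)+\tfrac a2\le r\}=\sup\{\tfrac a2-H(a): a\in\mathbb R,\ H(a)+\tfrac a2\le r\},$$ $$B^*_{e,P}(r)=\sup\{a-\zeta(a): a\in\mathbb R,\ \zeta(a)\le r\}.$$ -/

import Mathlib

open Filter Topology
open scoped ENNReal

noncomputable section

namespace EntConc

/-! ### Bipartite systems

A system with (finite or infinite) orthonormal basis indexed by `α` is the Hilbert space
`ℓ²(α, ℂ)`; the composite of the systems `ℓ²(α, ℂ)` and `ℓ²(β, ℂ)` is `ℓ²(α × β, ℂ)`. -/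

/-- The Hilbert space with orthonormal basis indexed by `α`. -/
abbrev Sys (α : Type) : Type := lp (fun _ : α => ℂ) 2

variable {α β α' β' : Type}

theorem summable_sq (x : Sys α) : Summable fun a => ‖x a‖ ^ 2 := by
  simpa using (lp.memℓp x).summable (by norm_num)

theorem norm_sq_eq (x : Sys α) : ‖x‖ ^ 2 = ∑' a, ‖x a‖ ^ 2 := by
  simpa using lp.norm_rpow_eq_tsum (p := 2) (by norm_num) x

theorem memℓp_of_summable_sq {f : α → ℂ} (h : Summable fun a => ‖f a‖ ^ 2) :
    Memℓp f 2 := memℓp_gen (by simpa using h)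

/-- The partial contraction `(1 ⊗ ⟨b|) Φ` of a bipartite vector with a basis vector of the second
system. -/
def sliceB (Φ : Sys (α × β)) (b : β) : Sys α :=
  ⟨fun a => Φ (a, b), memℓp_of_summable_sq
    ((summable_sq Φ).comp_injective (i := fun a : α => (a, b))
      (fun _ _ h => congrArg Prod.fst h))⟩

/-- The partial contraction `(⟨a| ⊗ 1) Φ` of a bipartite vector with a basis vector of the first
system. -/
def sliceA (Φ : Sys (α × β)) (a : α) : Sys β :=
  ⟨fun b => Φ (a, b), memℓp_of_summable_sq
    ((summable_sq Φ).comp_injective (i := fun b : β => (a, b))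
      (fun _ _ h => congrArg Prod.snd h))⟩

theorem summable_sliceB (Φ : Sys (α × β)) : Summable fun b => ‖sliceB Φ b‖ ^ 2 := by
  have h := (Equiv.prodComm β α).summable_iff.mpr (summable_sq Φ)
  have h2 := ((summable_prod_of_nonneg (fun _ => sq_nonneg _)).mp h).2
  refine h2.congr fun b => ?_
  rw [norm_sq_eq]
  rfl

theorem summable_sliceA (Φ : Sys (α × β)) : Summable fun a => ‖sliceA Φ a‖ ^ 2 := by
  have h2 := ((summable_prod_of_nonneg (fun _ => sq_nonneg _)).mp (summable_sq Φ)).2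
  refine h2.congr fun a => ?_
  rw [norm_sq_eq]
  rfl

/-- The vector `(A ⊗ 1) Φ`. -/
def actA (A : Sys α →L[ℂ] Sys α') (Φ : Sys (α × β)) : Sys (α' × β) :=
  ⟨fun p => A (sliceB Φ p.2) p.1, memℓp_of_summable_sq (by
    rw [← (Equiv.prodComm β α').summable_iff]
    refine (summable_prod_of_nonneg (fun _ => sq_nonneg _)).mpr
      ⟨fun b => summable_sq (A (sliceB Φ b)), ?_⟩
    refine Summable.of_nonneg_of_le (fun b => tsum_nonneg fun _ => by positivity) (fun b => ?_)
      ((summable_sliceB Φ).mul_left (‖A‖ ^ 2))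
    change ∑' a, ‖A (sliceB Φ b) a‖ ^ 2 ≤ _
    rw [← norm_sq_eq, ← mul_pow]
    exact pow_le_pow_left₀ (norm_nonneg _) (A.le_opNorm _) 2)⟩

/-- The vector `(1 ⊗ B) Φ`. -/
def actB (B : Sys β →L[ℂ] Sys β') (Φ : Sys (α × β)) : Sys (α × β') :=
  ⟨fun p => B (sliceA Φ p.1) p.2, memℓp_of_summable_sq (by
    refine (summable_prod_of_nonneg (fun _ => sq_nonneg _)).mpr
      ⟨fun a => summable_sq (B (sliceA Φ a)), ?_⟩
    refine Summable.of_nonneg_of_le (fun a => tsum_nonneg fun _ => by positivity) (fun a => ?_)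
      ((summable_sliceA Φ).mul_left (‖B‖ ^ 2))
    change ∑' b, ‖B (sliceA Φ a) b‖ ^ 2 ≤ _
    rw [← norm_sq_eq, ← mul_pow]
    exact pow_le_pow_left₀ (norm_nonneg _) (B.le_opNorm _) 2)⟩

theorem tsum_norm_sq_sliceB (Φ : Sys (α × β)) :
    ∑' b, ENNReal.ofReal (‖sliceB Φ b‖ ^ 2) = ENNReal.ofReal (‖Φ‖ ^ 2) := by
  have key : ∀ {γ : Type} (x : Sys γ),
      ENNReal.ofReal (‖x‖ ^ 2) = ∑' c, ENNReal.ofReal (‖x c‖ ^ 2) := fun x => by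
    rw [norm_sq_eq, ENNReal.ofReal_tsum_of_nonneg (fun _ => sq_nonneg _) (summable_sq x)]
  rw [key Φ, ENNReal.tsum_prod', ENNReal.tsum_comm]
  exact tsum_congr fun b => key _

theorem tsum_norm_sq_sliceA (Φ : Sys (α × β)) :
    ∑' a, ENNReal.ofReal (‖sliceA Φ a‖ ^ 2) = ENNReal.ofReal (‖Φ‖ ^ 2) := by
  have key : ∀ {γ : Type} (x : Sys γ),
      ENNReal.ofReal (‖x‖ ^ 2) = ∑' c, ENNReal.ofReal (‖x c‖ ^ 2) := fun x => by
    rw [norm_sq_eq, ENNReal.ofReal_tsum_of_nonneg (fun _ => sq_nonneg _) (summable_sq x)]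
  rw [key Φ, ENNReal.tsum_prod']
  exact tsum_congr fun b => key _

/-- The operator `|x⟩⟨x|`. -/
def ketbra (x : Sys α) : Sys α →L[ℂ] Sys α := InnerProductSpace.rankOne ℂ x x

/-- The reduced density `Tr_B |Φ⟩⟨Φ| = ∑_b (1 ⊗ ⟨b|) |Φ⟩⟨Φ| (1 ⊗ |b⟩)` on the first system.
The series converges absolutely in operator norm, as the next lemma records. -/
def reduced (Φ : Sys (α × β)) : Sys α →L[ℂ] Sys α := ∑' b, ketbra (sliceB Φ b)

theorem summable_reduced (Φ : Sys (α × β)) : Summable fun b => ketbra (sliceB Φ b) := by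
  refine Summable.of_norm ((summable_sliceB Φ).congr fun b => ?_)
  simp [ketbra, sq]

/-- `Ψ` is a maximally entangled state of size `L`, on a pair of `L`-dimensional subspaces:
`Ψ = L^{-1/2} ∑_{k < L} e_k ⊗ f_k` with orthonormal `e` and `f`. -/
def IsMaxEntangled (Ψ : Sys (α × β)) (L : ℕ) : Prop :=
  0 < L ∧ ∃ (e : Fin L → Sys α) (f : Fin L → Sys β), Orthonormal ℂ e ∧ Orthonormal ℂ f ∧
    ∀ a b, Ψ (a, b) = ((Real.sqrt L)⁻¹ : ℝ) * ∑ k, e k a * f k b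

/-! ### LOCC -/

/-- The Kraus operators of a measurement on one system: `∑_j K_j† K_j = 1`, expressed through the
quadratic forms of both sides. -/
def IsMeasurement {J : Type} (K : J → Sys α →L[ℂ] Sys α') : Prop :=
  ∀ x, HasSum (fun j => ‖K j x‖ ^ 2) (‖x‖ ^ 2)

theorem IsMeasurement.tsum_eq {J : Type} {K : J → Sys α →L[ℂ] Sys α'} (hK : IsMeasurement K)
    (x : Sys α) : ∑' j, ENNReal.ofReal (‖K j x‖ ^ 2) = ENNReal.ofReal (‖x‖ ^ 2) := by
  rw [← (hK x).tsum_eq, ENNReal.ofReal_tsum_of_nonneg (fun _ => sq_nonneg _) (hK x).summable]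

theorem IsMeasurement.tsum_actA {J : Type} {K : J → Sys α →L[ℂ] Sys α'} (hK : IsMeasurement K)
    (Φ : Sys (α × β)) :
    ∑' j, ENNReal.ofReal (‖actA (K j) Φ‖ ^ 2) = ENNReal.ofReal (‖Φ‖ ^ 2) := by
  simp_rw [← tsum_norm_sq_sliceB]
  rw [ENNReal.tsum_comm]
  exact tsum_congr fun b => hK.tsum_eq (sliceB Φ b)

theorem IsMeasurement.tsum_actB {J : Type} {K : J → Sys β →L[ℂ] Sys β'} (hK : IsMeasurement K)
    (Φ : Sys (α × β)) :
    ∑' j, ENNReal.ofReal (‖actB (K j) Φ‖ ^ 2) = ENNReal.ofReal (‖Φ‖ ^ 2) := by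
  simp_rw [← tsum_norm_sq_sliceA]
  rw [ENNReal.tsum_comm]
  exact tsum_congr fun a => hK.tsum_eq (sliceA Φ a)

/-- LOCC protocols with at most `n` rounds that turn a system `α × β` into a system `α' × β'`. In
each round one party performs a measurement on its own system and announces the outcome; all later
steps may depend on it. The spaces may change in each round (local ancillas can be added or
discarded). Coarse-grained outcomes are obtained by forgetting part of the record. -/
inductive LOCC (α' β' : Type) : ℕ → Type → Type → Type 1
  | done {n : ℕ} : LOCC α' β' n α' β'
  | alice {n : ℕ} {α β α₁ J : Type} (K : J → Sys α →L[ℂ] Sys α₁) (hK : IsMeasurement K)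
      (next : J → LOCC α' β' n α₁ β) : LOCC α' β' (n + 1) α β
  | bob {n : ℕ} {α β β₁ J : Type} (K : J → Sys β →L[ℂ] Sys β₁) (hK : IsMeasurement K)
      (next : J → LOCC α' β' n α β₁) : LOCC α' β' (n + 1) α β

namespace LOCC

/-- The complete measurement records of a protocol. -/
def Record : {n : ℕ} → {α β : Type} → LOCC α' β' n α β → Type
  | _, _, _, done => Unit
  | _, _, _, alice (J := J) _ _ next => Σ j : J, (next j).Record
  | _, _, _, bob (J := J) _ _ next => Σ j : J, (next j).Record

/-- The unnormalized final vector, on the initial vector `Φ`, for each measurement record. -/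
def final : {n : ℕ} → {α β : Type} → (P : LOCC α' β' n α β) → Sys (α × β) → P.Record →
    Sys (α' × β')
  | _, _, _, done, Φ, _ => Φ
  | _, _, _, alice K _ next, Φ, ω => (next ω.1).final (actA (K ω.1) Φ) ω.2
  | _, _, _, bob K _ next, Φ, ω => (next ω.1).final (actB (K ω.1) Φ) ω.2

/-- LOCC operations preserve the trace. -/
theorem tsum_final : {n : ℕ} → {α β : Type} → (P : LOCC α' β' n α β) → (Φ : Sys (α × β)) →
    ∑' ω, ENNReal.ofReal (‖P.final Φ ω‖ ^ 2) = ENNReal.ofReal (‖Φ‖ ^ 2)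
  | _, _, _, done, Φ => by
    change ∑' _ : Unit, ENNReal.ofReal (‖Φ‖ ^ 2) = _
    simp
  | _, _, _, alice K hK next, Φ => by
    rw [← hK.tsum_actA Φ]
    refine (ENNReal.tsum_sigma' _).trans (tsum_congr fun j => ?_)
    exact tsum_final (next j) (actA (K j) Φ)
  | _, _, _, bob K hK next, Φ => by
    rw [← hK.tsum_actB Φ]
    refine (ENNReal.tsum_sigma' _).trans (tsum_congr fun j => ?_)
    exact tsum_final (next j) (actB (K j) Φ)

variable {n : ℕ}

/-- The series of final states converges absolutely in operator norm. -/
theorem summable_final (P : LOCC α' β' n α β) (Φ : Sys (α × β)) :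
    Summable fun ω => ketbra (P.final Φ ω) := by
  refine Summable.of_norm ?_
  have h : Summable fun ω => ‖P.final Φ ω‖ ^ 2 := by
    have := ENNReal.summable_toReal (f := fun ω => ENNReal.ofReal (‖P.final Φ ω‖ ^ 2))
      (by rw [tsum_final]; exact ENNReal.ofReal_ne_top)
    refine this.congr fun ω => ?_
    exact ENNReal.toReal_ofReal (sq_nonneg _)
  refine h.congr fun ω => ?_
  simp [ketbra, sq]

/-- The unnormalized final state `I_S(Φ)` for the event that the record lies in `S`. For
`S = Set.univ` this is the final state `C(Φ)` of the quantum operation without selection. -/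
def output (P : LOCC α' β' n α β) (Φ : Sys (α × β)) (S : Set P.Record) :
    Sys (α' × β') →L[ℂ] Sys (α' × β') := ∑' ω : S, ketbra (P.final Φ ω)

/-- The probability `Tr I_S(Φ)` of the event that the record lies in `S`. -/
def prob (P : LOCC α' β' n α β) (Φ : Sys (α × β)) (S : Set P.Record) : ℝ≥0∞ :=
  ∑' ω : S, ENNReal.ofReal (‖P.final Φ ω‖ ^ 2)

end LOCC

/-! ### Fixed-length entanglement concentration -/

/-- A deterministic fixed-length entanglement concentration: an LOCC operation together with a
maximally entangled target state. -/
structure DFLEC (α β : Type) where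
  outA : Type
  outB : Type
  rounds : ℕ
  op : LOCC outA outB rounds α β
  size : ℕ
  target : Sys (outA × outB)
  target_spec : IsMaxEntangled target size

/-- The fidelity `⟨Ψ| C(Φ) |Ψ⟩`. -/
def DFLEC.fidelity (D : DFLEC α β) (Φ : Sys (α × β)) : ℝ≥0∞ :=
  ENNReal.ofReal (inner ℂ D.target (D.op.output Φ Set.univ D.target)).re

/-- A probabilistic fixed-length entanglement concentration of `Φ`: a two-valued LOCC instrument
`(I₀, I₁)`, where `I₁` corresponds to the records in `success`, with
`I₁(Φ) = Tr I₁(Φ) • |Ψ⟩⟨Ψ|` for a maximally entangled state `Ψ`. The condition is written without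
division by `Tr I₁(Φ)`; an instrument that never succeeds is thus not excluded. -/
structure PFLEC (Φ : Sys (α × β)) where
  outA : Type
  outB : Type
  rounds : ℕ
  op : LOCC outA outB rounds α β
  success : Set op.Record
  size : ℕ
  target : Sys (outA × outB)
  target_spec : IsMaxEntangled target size
  output_eq : op.output Φ success = (op.prob Φ success).toReal • ketbra target

/-- The success probability `Tr I₁(Φ)`. -/
def PFLEC.succProb {Φ : Sys (α × β)} (I : PFLEC Φ) : ℝ≥0∞ := I.op.prob Φ I.success

/-- The failure probability `Tr I₀(Φ)`. -/
def PFLEC.failProb {Φ : Sys (α × β)} (I : PFLEC Φ) : ℝ≥0∞ := I.op.prob Φ I.successᶜ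

/-! ### Asymptotic quantities -/

/-- `-(1/n) log p`, with value `+∞` at `p = 0`. -/
def expo (n : ℕ) (p : ℝ≥0∞) : EReal := -ENNReal.log p / (n : EReal)

/-- `liminf (1/n) log L_n`. -/
def rate (L : ℕ → ℕ) : EReal := liminf (fun n => ((Real.log (L n) / n : ℝ) : EReal)) atTop

variable {ι κ : ℕ → Type} (Φ : ∀ n, Sys (ι n × κ n))

/-- `B_P(ε)`. -/
def BP (ε : ℝ) : EReal :=
  ⨆ (I : ∀ n, PFLEC (Φ n))
    (_ : limsup (fun n => (I n).failProb) atTop ≤ ENNReal.ofReal ε),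
    rate fun n => (I n).size

/-- `B_{e,P}(r)`. -/
def BeP (r : ℝ) : EReal :=
  ⨆ (I : ∀ n, PFLEC (Φ n))
    (_ : (r : EReal) ≤ liminf (fun n => expo n (I n).failProb) atTop),
    rate fun n => (I n).size

/-- `B_{e,P}^*(r)`. -/
def BePStar (r : ℝ) : EReal :=
  ⨆ (I : ∀ n, PFLEC (Φ n))
    (_ : limsup (fun n => expo n (I n).succProb) atTop ≤ (r : EReal)),
    rate fun n => (I n).size

/-- `B_D(ε)`. -/
def BD (ε : ℝ) : EReal :=
  ⨆ (D : ∀ n, DFLEC (ι n) (κ n))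
    (_ : ENNReal.ofReal (1 - ε) ≤ liminf (fun n => (D n).fidelity (Φ n)) atTop),
    rate fun n => (D n).size

/-- `B_{e,D}(r)`. -/
def BeD (r : ℝ) : EReal :=
  ⨆ (D : ∀ n, DFLEC (ι n) (κ n))
    (_ : (r : EReal) ≤ liminf (fun n => expo n (1 - (D n).fidelity (Φ n))) atTop),
    rate fun n => (D n).size

/-- `B_{e,D}^*(r)`. -/
def BeDStar (r : ℝ) : EReal :=
  ⨆ (D : ∀ n, DFLEC (ι n) (κ n))
    (_ : limsup (fun n => expo n ((D n).fidelity (Φ n))) atTop ≤ (r : EReal)),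
    rate fun n => (D n).size

/-- `Tr ρ {ρ ∈ S}`, where `{ρ ∈ S}` is the spectral projection of the reduced density `ρ`: the sum
of the eigenvalues of `ρ` in `S`, each counted with its multiplicity. -/
def specMass (ρ : Sys α →L[ℂ] Sys α) (S : Set ℝ) : ℝ≥0∞ :=
  ∑' x : S, ENNReal.ofReal x *
    (Module.finrank ℂ (Module.End.eigenspace (ρ : Sys α →ₗ[ℂ] Sys α) ((x : ℝ) : ℂ)) : ℝ≥0∞)

/-- `K(a) = limsup Tr ρ_n {ρ_n ≥ e^{-na}}`. -/
def K (a : ℝ) : ℝ≥0∞ :=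
  limsup (fun n : ℕ => specMass (reduced (Φ n)) (Set.Ici (Real.exp (-n * a)))) atTop

/-- `liminf -(1/n) log Tr ρ_n {ρ_n > e^{-na}}`. -/
def zetaC (a : ℝ) : EReal :=
  liminf (fun n : ℕ => expo n (specMass (reduced (Φ n)) (Set.Ioi (Real.exp (-n * a))))) atTop

/-- For every real `a`, the limit of `-(1/n) log Tr ρ_n {ρ_n < e^{-na}}` exists in `[0, ∞]` and
equals `ζ a`. -/
def IsZeta (ζ : ℝ → EReal) : Prop :=
  ∀ a : ℝ, Tendsto
    (fun n : ℕ => expo n (specMass (reduced (Φ n)) (Set.Iio (Real.exp (-n * a)))))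
    atTop (𝓝 (ζ a))

/-- `inf_{a' ≤ a} (ζ(a') - a'/2)`. -/
def infHalf (ζ : ℝ → EReal) (a : ℝ) : EReal :=
  ⨅ (a' : ℝ) (_ : a' ≤ a), (ζ a' - ((a' / 2 : ℝ) : EReal))

end EntConc

end

noncomputable section

namespace EntConc

section Spectral

variable {α β : Type}

theorem ketbra_apply (x y : Sys α) : ketbra x y = inner ℂ x y • x := by
  simp [ketbra]

theorem hasSum_reduced_apply (Φ : Sys (α × β)) (x : Sys α) :
    HasSum (fun b => inner ℂ (sliceB Φ b) x • sliceB Φ b) (reduced Φ x) := by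
  have h := (ContinuousLinearMap.apply ℂ (Sys α) x).hasSum (summable_reduced Φ).hasSum
  simpa [ketbra_apply, reduced] using h

theorem hasSum_inner_reduced (Φ : Sys (α × β)) (x y : Sys α) :
    HasSum (fun b => inner ℂ (sliceB Φ b) x * inner ℂ y (sliceB Φ b))
      (inner ℂ y (reduced Φ x)) := by
  have h := (innerSL ℂ y).hasSum (hasSum_reduced_apply Φ x)
  simpa [inner_smul_right] using h

theorem hasSum_norm_inner_sliceB (Φ : Sys (α × β)) (x : Sys α) :
    HasSum (fun b => ‖inner ℂ x (sliceB Φ b)‖ ^ 2) (inner ℂ x (reduced Φ x)).re := by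
  have h := Complex.hasSum_re (hasSum_inner_reduced Φ x x)
  refine h.congr_fun fun b => ?_
  have h2 : (inner ℂ (sliceB Φ b) x * inner ℂ x (sliceB Φ b)).re = _ :=
    inner_mul_symm_re_eq_norm (𝕜 := ℂ) (sliceB Φ b) x
  rw [h2, norm_mul, norm_inner_symm, sq]

theorem isSymmetric_reduced (Φ : Sys (α × β)) :
    (reduced Φ : Sys α →ₗ[ℂ] Sys α).IsSymmetric := by
  intro x y
  have h1 := hasSum_inner_reduced Φ y x
  have h2 := (hasSum_inner_reduced Φ x y).star
  have h3 : star (inner ℂ y (reduced Φ x)) = inner ℂ (reduced Φ x) y := inner_conj_symm _ _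
  rw [h3] at h2
  refine h2.unique (h1.congr_fun fun b => ?_)
  simp [mul_comm]

theorem isCompactOperator_reduced (Φ : Sys (α × β)) : IsCompactOperator (reduced Φ) := by
  refine isCompactOperator_of_tendsto (summable_reduced Φ).hasSum (Eventually.of_forall fun s => ?_)
  have hs : ∀ b, IsCompactOperator (ketbra (sliceB Φ b)) := fun b => by
    have h : IsCompactOperator (innerSL ℂ (sliceB Φ b)) :=
      isCompactOperator_of_locallyCompactSpace_dom (innerSL ℂ (sliceB Φ b))
    have h2 := h.clm_comp (ContinuousLinearMap.toSpanSingleton ℂ (sliceB Φ b))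
    have h3 : ⇑(ContinuousLinearMap.toSpanSingleton ℂ (sliceB Φ b)) ∘
        ⇑(innerSL ℂ (sliceB Φ b)) = ⇑(ketbra (sliceB Φ b)) := by
      funext x
      simp [ketbra_apply]
    rwa [h3] at h2
  classical
  induction s using Finset.induction_on with
  | empty => simpa using isCompactOperator_zero
  | insert b s hb ih =>
    rw [Finset.sum_insert hb]
    exact (hs b).add ih

/-- A system of orthonormal eigenvectors of the reduced density that exhausts its trace. -/
structure SpectralData (Φ : Sys (α × β)) where
  I : Type
  p : I → ℝ
  e : I → Sys α
  pos : ∀ i, 0 < p i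
  orthonormal : Orthonormal ℂ e
  eigen : ∀ i, reduced Φ (e i) = (p i : ℂ) • e i
  specMass_eq : ∀ S : Set ℝ, specMass (reduced Φ) S =
    ∑' i, (p ⁻¹' S).indicator (fun i => ENNReal.ofReal (p i)) i
  tsum_eq : ∑' i, ENNReal.ofReal (p i) = ENNReal.ofReal (‖Φ‖ ^ 2)

theorem eigenvalue_nonneg_of_reduced (Φ : Sys (α × β)) {μ : ℂ} {v : Sys α} (hv : v ≠ 0)
    (h : reduced Φ v = μ • v) : 0 ≤ μ.re ∧ μ = (μ.re : ℂ) := by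
  have hn : 0 < ‖v‖ ^ 2 := by positivity
  have h1 : inner ℂ v (reduced Φ v) = μ * ((‖v‖ ^ 2 : ℝ) : ℂ) := by
    rw [h, inner_smul_right, inner_self_eq_norm_sq_to_K]; norm_cast
  have hre := hasSum_norm_inner_sliceB Φ v
  have h0 : 0 ≤ (inner ℂ v (reduced Φ v)).re := hre.nonneg fun _ => by positivity
  have him : (inner ℂ v (reduced Φ v)).im = 0 := by
    have := (isSymmetric_reduced Φ).im_inner_self_apply v
    simpa using this
  rw [h1] at h0 him
  rw [Complex.re_mul_ofReal] at h0
  rw [Complex.im_mul_ofReal] at him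
  refine ⟨nonneg_of_mul_nonneg_left h0 hn, Complex.ext rfl ?_⟩
  simpa [hn.ne'] using him

theorem inner_sliceB_eq_zero (Φ : Sys (α × β)) {y : Sys α}
    (hy : ∀ x : ℝ, 0 < x → ∀ v : Sys α, reduced Φ v = (x : ℂ) • v → inner ℂ v y = 0) (b : β) :
    inner ℂ y (sliceB Φ b) = 0 := by
  have hsym := isSymmetric_reduced Φ
  have key : reduced Φ y ∈
      (⨆ μ, Module.End.eigenspace (reduced Φ : Sys α →ₗ[ℂ] Sys α) μ)ᗮ := by
    rw [← Submodule.iInf_orthogonal, Submodule.mem_iInf]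
    intro μ
    rw [Submodule.mem_orthogonal]
    intro v hv
    rw [Module.End.mem_eigenspace_iff] at hv
    have hs : inner ℂ v (reduced Φ y) = inner ℂ (reduced Φ v) y := (hsym v y).symm
    by_cases hv0 : v = 0
    · simp [hv0]
    obtain ⟨h0, hμ⟩ := eigenvalue_nonneg_of_reduced Φ hv0 hv
    have hv' : reduced Φ v = μ • v := hv
    rw [hs, hv', inner_smul_left]
    rcases h0.eq_or_lt with h0 | h0
    · rw [hμ, ← h0]; simp
    · rw [hy μ.re h0 v (hμ ▸ hv'), mul_zero]
  rw [ContinuousLinearMap.orthogonalComplement_iSup_eigenspaces_eq_bot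
    (isCompactOperator_reduced Φ) hsym, Submodule.mem_bot] at key
  have h := hasSum_norm_inner_sliceB Φ y
  rw [key, inner_zero_right, Complex.zero_re,
    hasSum_zero_iff_of_nonneg (fun _ => by positivity)] at h
  simpa using congrFun h b

theorem norm_sq_eq_tsum_of_orthonormal {I : Type} {e : I → Sys α} (he : Orthonormal ℂ e)
    {x : Sys α} (hx : ∀ y, (∀ i, inner ℂ (e i) y = 0) → inner ℂ y x = 0) :
    ∑' i, ENNReal.ofReal (‖inner ℂ (e i) x‖ ^ 2) = ENNReal.ofReal (‖x‖ ^ 2) := by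
  obtain ⟨w, B, hw, hB⟩ := he.toSubtypeRange.exists_hilbertBasis_extension
  have hsum : ∑' z : w, ENNReal.ofReal (‖inner ℂ (z : Sys α) x‖ ^ 2) =
      ENNReal.ofReal (‖x‖ ^ 2) := by
    have h1 : ‖B.repr x‖ ^ 2 = ‖x‖ ^ 2 := by rw [B.repr.norm_map]
    have h2 : ENNReal.ofReal (‖B.repr x‖ ^ 2) = ∑' z : w, ENNReal.ofReal (‖B.repr x z‖ ^ 2) := by
      have hs : Summable fun z => ‖B.repr x z‖ ^ 2 := by
        simpa using (lp.memℓp (B.repr x)).summable (by norm_num)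
      have := lp.norm_rpow_eq_tsum (p := 2) (by norm_num) (B.repr x)
      rw [← ENNReal.ofReal_tsum_of_nonneg (fun _ => sq_nonneg _) hs]
      congr 1
      simpa using this
    rw [← h1, h2]
    simp [B.repr_apply_apply, hB]
  rw [← hsum]
  let g : I → w := fun i => ⟨e i, hw ⟨i, rfl⟩⟩
  have hg : Function.Injective g := fun i j h =>
    he.linearIndependent.injective (congrArg Subtype.val h)
  refine hg.tsum_eq (f := fun z : w => ENNReal.ofReal (‖inner ℂ (z : Sys α) x‖ ^ 2)) ?_
  intro z hz
  by_contra hzr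
  refine hz ?_
  have : inner ℂ (z : Sys α) x = 0 := hx z fun i => by
    have ho := B.orthonormal
    rw [hB] at ho
    exact ho.2 (i := g i) (j := z) fun h => hzr ⟨i, h⟩
  simp [this]

/-- The eigenspace of the reduced density for a positive eigenvalue. -/
def posEigenspace (Φ : Sys (α × β)) (x : {x : ℝ // 0 < x}) : Submodule ℂ (Sys α) :=
  Module.End.eigenspace (reduced Φ : Sys α →ₗ[ℂ] Sys α) ((x : ℝ) : ℂ)

instance (Φ : Sys (α × β)) (x : {x : ℝ // 0 < x}) : FiniteDimensional ℂ (posEigenspace Φ x) :=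
  ContinuousLinearMap.finite_dimensional_eigenspace (isCompactOperator_reduced Φ) _
    (by exact_mod_cast x.2.ne')

/-- The positive eigenvalues of the reduced density, repeated according to multiplicity. -/
abbrev EigenIndex (Φ : Sys (α × β)) : Type :=
  Σ x : {x : ℝ // 0 < x}, Fin (Module.finrank ℂ (posEigenspace Φ x))

/-- An orthonormal system of eigenvectors for the positive eigenvalues. -/
def eigenvec (Φ : Sys (α × β)) (i : EigenIndex Φ) : Sys α :=
  (stdOrthonormalBasis ℂ (posEigenspace Φ i.1) i.2 : posEigenspace Φ i.1)

theorem orthonormal_eigenvec (Φ : Sys (α × β)) : Orthonormal ℂ (eigenvec Φ) := by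
  refine ⟨fun i => (stdOrthonormalBasis ℂ (posEigenspace Φ i.1)).orthonormal.1 i.2, ?_⟩
  rintro ⟨x, k⟩ ⟨y, l⟩ hne
  by_cases hxy : x = y
  · subst hxy
    exact (stdOrthonormalBasis ℂ (posEigenspace Φ x)).orthonormal.2 fun h =>
      hne (Sigma.ext rfl (heq_of_eq h))
  · have hxy' : ((x : ℝ) : ℂ) ≠ ((y : ℝ) : ℂ) := fun h =>
      hxy (Subtype.ext (Complex.ofReal_injective h))
    exact (isSymmetric_reduced Φ).orthogonalFamily_eigenspaces hxy'
      (stdOrthonormalBasis ℂ (posEigenspace Φ x) k) (stdOrthonormalBasis ℂ (posEigenspace Φ y) l)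

theorem reduced_eigenvec (Φ : Sys (α × β)) (i : EigenIndex Φ) :
    reduced Φ (eigenvec Φ i) = ((i.1 : ℝ) : ℂ) • eigenvec Φ i :=
  Module.End.mem_eigenspace_iff.mp (stdOrthonormalBasis ℂ (posEigenspace Φ i.1) i.2).2

theorem inner_eq_zero_of_eigenvec (Φ : Sys (α × β)) {y : Sys α}
    (hy : ∀ i, inner ℂ (eigenvec Φ i) y = 0) (x : ℝ) (hx : 0 < x) (v : Sys α)
    (hv : reduced Φ v = (x : ℂ) • v) : inner ℂ v y = 0 := by
  let v' : posEigenspace Φ ⟨x, hx⟩ := ⟨v, Module.End.mem_eigenspace_iff.mpr hv⟩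
  have h := (stdOrthonormalBasis ℂ (posEigenspace Φ ⟨x, hx⟩)).sum_repr v'
  have h2 : v = ∑ k, (stdOrthonormalBasis ℂ (posEigenspace Φ ⟨x, hx⟩)).repr v' k •
      eigenvec Φ ⟨⟨x, hx⟩, k⟩ := by
    have := congrArg (Submodule.subtype _) h
    rw [map_sum] at this
    exact this.symm
  rw [h2, sum_inner]
  refine Finset.sum_eq_zero fun k _ => ?_
  rw [inner_smul_left, hy, mul_zero]

theorem tsum_eigenvalue (Φ : Sys (α × β)) :
    ∑' i : EigenIndex Φ, ENNReal.ofReal (i.1 : ℝ) = ENNReal.ofReal (‖Φ‖ ^ 2) := by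
  have hp : ∀ i : EigenIndex Φ, ENNReal.ofReal (i.1 : ℝ) =
      ∑' b, ENNReal.ofReal (‖inner ℂ (eigenvec Φ i) (sliceB Φ b)‖ ^ 2) := by
    intro i
    have h := hasSum_norm_inner_sliceB Φ (eigenvec Φ i)
    rw [reduced_eigenvec, inner_smul_right, inner_self_eq_norm_sq_to_K,
      (orthonormal_eigenvec Φ).1 i] at h
    rw [← ENNReal.ofReal_tsum_of_nonneg (fun _ => by positivity) h.summable, h.tsum_eq]
    simp
  rw [tsum_congr hp, ENNReal.tsum_comm, ← tsum_norm_sq_sliceB]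
  exact tsum_congr fun b => norm_sq_eq_tsum_of_orthonormal (orthonormal_eigenvec Φ) fun y hy =>
    inner_sliceB_eq_zero Φ (inner_eq_zero_of_eigenvec Φ hy) b

theorem specMass_eq_tsum_eigenvalue (Φ : Sys (α × β)) (S : Set ℝ) :
    specMass (reduced Φ) S = ∑' i : EigenIndex Φ,
      ((fun i : EigenIndex Φ => (i.1 : ℝ)) ⁻¹' S).indicator
        (fun i => ENNReal.ofReal (i.1 : ℝ)) i := by
  let m : ℝ → ℝ≥0∞ := fun x => ENNReal.ofReal x *
    (Module.finrank ℂ (Module.End.eigenspace (reduced Φ : Sys α →ₗ[ℂ] Sys α) (x : ℂ)) : ℝ≥0∞)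
  have h1 : ∀ x : {x : ℝ // 0 < x}, ∑' k : Fin (Module.finrank ℂ (posEigenspace Φ x)),
      ((fun i : EigenIndex Φ => (i.1 : ℝ)) ⁻¹' S).indicator
        (fun i => ENNReal.ofReal (i.1 : ℝ)) ⟨x, k⟩ = S.indicator m x := by
    intro x
    by_cases hx : (x : ℝ) ∈ S
    · have : ∀ k, (⟨x, k⟩ : EigenIndex Φ) ∈ (fun i : EigenIndex Φ => (i.1 : ℝ)) ⁻¹' S :=
        fun k => hx
      simp only [Set.indicator_of_mem hx, Set.indicator_of_mem (this _)]
      rw [tsum_fintype, Finset.sum_const, nsmul_eq_mul, mul_comm, Finset.card_fin]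
      rfl
    · have : ∀ k, (⟨x, k⟩ : EigenIndex Φ) ∉ (fun i : EigenIndex Φ => (i.1 : ℝ)) ⁻¹' S :=
        fun k => hx
      simp only [Set.indicator_of_notMem hx, Set.indicator_of_notMem (this _), tsum_zero]
  rw [ENNReal.tsum_sigma', tsum_congr h1]
  refine (tsum_subtype S m).trans (Function.Injective.tsum_eq Subtype.val_injective ?_).symm
  intro x hx
  by_contra h
  refine hx ?_
  have hx0 : x ≤ 0 := by simpa using h
  simp [m, Set.indicator, ENNReal.ofReal_of_nonpos hx0]

theorem nonempty_spectralData (Φ : Sys (α × β)) : Nonempty (SpectralData Φ) :=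
  ⟨{ I := EigenIndex Φ
     p := fun i => i.1
     e := eigenvec Φ
     pos := fun i => i.1.2
     orthonormal := orthonormal_eigenvec Φ
     eigen := reduced_eigenvec Φ
     specMass_eq := specMass_eq_tsum_eigenvalue Φ
     tsum_eq := tsum_eigenvalue Φ }⟩

end Spectral

section Tensor

variable {α β α' β' : Type}

/-- The product vector `u ⊗ v`. -/
def tens (u : Sys α) (v : Sys β) : Sys (α × β) :=
  ⟨fun p => u p.1 * v p.2, memℓp_of_summable_sq (by
    simpa [mul_pow] using (summable_sq u).mul_of_nonneg (summable_sq v)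
      (fun _ => sq_nonneg _) (fun _ => sq_nonneg _))⟩

/-- The partial contraction `(⟨x| ⊗ 1) Φ`. -/
def contr (x : Sys α) (Φ : Sys (α × β)) : Sys β :=
  ⟨fun b => inner ℂ x (sliceB Φ b), memℓp_of_summable_sq (hasSum_norm_inner_sliceB Φ x).summable⟩

@[simp] theorem tens_apply (u : Sys α) (v : Sys β) (p : α × β) : tens u v p = u p.1 * v p.2 := rfl

@[simp] theorem contr_apply (x : Sys α) (Φ : Sys (α × β)) (b : β) :
    contr x Φ b = inner ℂ x (sliceB Φ b) := rfl

@[simp] theorem sliceB_apply (Φ : Sys (α × β)) (b : β) (a : α) : sliceB Φ b a = Φ (a, b) := rfl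

@[simp] theorem sliceA_apply (Φ : Sys (α × β)) (a : α) (b : β) : sliceA Φ a b = Φ (a, b) := rfl

@[simp] theorem actA_apply (A : Sys α →L[ℂ] Sys α') (Φ : Sys (α × β)) (p : α' × β) :
    actA A Φ p = A (sliceB Φ p.2) p.1 := rfl

@[simp] theorem actB_apply (B : Sys β →L[ℂ] Sys β') (Φ : Sys (α × β)) (p : α × β') :
    actB B Φ p = B (sliceA Φ p.1) p.2 := rfl

theorem sliceB_add (Φ Φ' : Sys (α × β)) (b : β) :
    sliceB (Φ + Φ') b = sliceB Φ b + sliceB Φ' b := rfl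

theorem sliceA_add (Φ Φ' : Sys (α × β)) (a : α) :
    sliceA (Φ + Φ') a = sliceA Φ a + sliceA Φ' a := rfl

theorem actA_add (A : Sys α →L[ℂ] Sys α') (Φ Φ' : Sys (α × β)) :
    actA A (Φ + Φ') = actA A Φ + actA A Φ' := by
  ext p
  simp [sliceB_add]

theorem actB_add (B : Sys β →L[ℂ] Sys β') (Φ Φ' : Sys (α × β)) :
    actB B (Φ + Φ') = actB B Φ + actB B Φ' := by
  ext p
  simp [sliceA_add]

theorem sliceB_tens (u : Sys α) (v : Sys β) (b : β) : sliceB (tens u v) b = v b • u := by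
  ext a
  simp [mul_comm]

theorem sliceA_tens (u : Sys α) (v : Sys β) (a : α) : sliceA (tens u v) a = u a • v := by
  ext b
  simp

theorem actA_tens (A : Sys α →L[ℂ] Sys α') (u : Sys α) (v : Sys β) :
    actA A (tens u v) = tens (A u) v := by
  ext p
  simp [sliceB_tens, mul_comm]

theorem actB_tens (B : Sys β →L[ℂ] Sys β') (u : Sys α) (v : Sys β) :
    actB B (tens u v) = tens u (B v) := by
  ext p
  simp [sliceA_tens]

theorem actA_sum {J : Type} (A : Sys α →L[ℂ] Sys α') (s : Finset J) (Φ : J → Sys (α × β)) :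
    actA A (∑ j ∈ s, Φ j) = ∑ j ∈ s, actA A (Φ j) :=
  map_sum (AddMonoidHom.mk' (actA A) (actA_add A)) Φ s

theorem actB_sum {J : Type} (B : Sys β →L[ℂ] Sys β') (s : Finset J) (Φ : J → Sys (α × β)) :
    actB B (∑ j ∈ s, Φ j) = ∑ j ∈ s, actB B (Φ j) :=
  map_sum (AddMonoidHom.mk' (actB B) (actB_add B)) Φ s

theorem tens_sum_left {J : Type} (s : Finset J) (u : J → Sys α) (v : Sys β) :
    tens (∑ j ∈ s, u j) v = ∑ j ∈ s, tens (u j) v :=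
  map_sum (AddMonoidHom.mk' (fun u => tens u v) fun u u' => by ext p; simp [add_mul]) u s

theorem tens_sum_right {J : Type} (s : Finset J) (u : Sys α) (v : J → Sys β) :
    tens u (∑ j ∈ s, v j) = ∑ j ∈ s, tens u (v j) :=
  map_sum (AddMonoidHom.mk' (fun v => tens u v) fun v v' => by ext p; simp [mul_add]) v s

theorem tens_smul_left (c : ℂ) (u : Sys α) (v : Sys β) : tens (c • u) v = tens u (c • v) := by
  ext p
  simp only [tens_apply, lp.coeFn_smul, Pi.smul_apply, smul_eq_mul]
  ring

theorem inner_tens_left (u : Sys α) (v : Sys β) (Φ : Sys (α × β)) :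
    inner ℂ (tens u v) Φ = inner ℂ v (contr u Φ) := by
  have h := lp.hasSum_inner (𝕜 := ℂ) (tens u v) Φ
  have h' := (Equiv.prodComm β α).hasSum_iff.mpr h
  refine (h'.prod_fiberwise fun b => ?_).unique (lp.hasSum_inner (𝕜 := ℂ) v (contr u Φ))
  have h2 := (lp.hasSum_inner (𝕜 := ℂ) u (sliceB Φ b)).mul_right (star (v b))
  simp only [RCLike.inner_apply, Function.comp_def, Equiv.prodComm_apply, Prod.swap,
    tens_apply, contr_apply, sliceB_apply, map_mul] at h2 ⊢
  refine h2.congr_fun fun a => ?_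
  simp only [RCLike.star_def]
  ring

theorem contr_tens (x u : Sys α) (v : Sys β) : contr x (tens u v) = inner ℂ x u • v := by
  ext b
  simp [sliceB_tens, mul_comm]

theorem inner_tens_tens (u u' : Sys α) (v v' : Sys β) :
    inner ℂ (tens u v) (tens u' v') = inner ℂ u u' * inner ℂ v v' := by
  rw [inner_tens_left, contr_tens, inner_smul_right]

theorem inner_contr_contr (Φ : Sys (α × β)) (x y : Sys α) :
    inner ℂ (contr x Φ) (contr y Φ) = inner ℂ y (reduced Φ x) := by
  refine (lp.hasSum_inner (𝕜 := ℂ) (contr x Φ) (contr y Φ)).unique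
    ((hasSum_inner_reduced Φ x y).congr_fun fun b => ?_)
  simp only [RCLike.inner_apply, contr_apply, inner_conj_symm]
  ring

theorem inner_sum_tens {J : Type} [Fintype J] {g : J → Sys α} (hg : Orthonormal ℂ g)
    (v w : J → Sys β) :
    inner ℂ (∑ j, tens (g j) (v j)) (∑ j, tens (g j) (w j)) = ∑ j, inner ℂ (v j) (w j) := by
  classical
  simp only [sum_inner, inner_sum, inner_tens_tens]
  refine Finset.sum_congr rfl fun j _ => ?_
  simp [orthonormal_iff_ite.mp hg]

theorem norm_sq_sum_tens {J : Type} [Fintype J] {g : J → Sys α} (hg : Orthonormal ℂ g)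
    (v : J → Sys β) : ‖∑ j, tens (g j) (v j)‖ ^ 2 = ∑ j, ‖v j‖ ^ 2 := by
  have h := inner_sum_tens hg v v
  simp only [inner_self_eq_norm_sq_to_K] at h
  exact_mod_cast h

/-- The vector has Schmidt rank at most `k`. -/
def SchmidtRankLE (χ : Sys (α × β)) (k : ℕ) : Prop :=
  ∃ (u : Fin k → Sys α) (v : Fin k → Sys β), χ = ∑ i, tens (u i) (v i)

theorem SchmidtRankLE.sum_tens {J : Type} (s : Finset J) (u : J → Sys α) (v : J → Sys β) :
    SchmidtRankLE (∑ i ∈ s, tens (u i) (v i)) s.card := by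
  refine ⟨fun k => u (s.equivFin.symm k), fun k => v (s.equivFin.symm k), ?_⟩
  rw [← Finset.sum_coe_sort s,
    ← s.equivFin.symm.sum_comp fun i : s => tens (u i) (v i)]

theorem SchmidtRankLE.actA {χ : Sys (α × β)} {k : ℕ} (h : SchmidtRankLE χ k)
    (A : Sys α →L[ℂ] Sys α') : SchmidtRankLE (actA A χ) k := by
  obtain ⟨u, v, rfl⟩ := h
  exact ⟨fun i => A (u i), v, by simp [actA_sum, actA_tens]⟩

theorem SchmidtRankLE.actB {χ : Sys (α × β)} {k : ℕ} (h : SchmidtRankLE χ k)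
    (B : Sys β →L[ℂ] Sys β') : SchmidtRankLE (actB B χ) k := by
  obtain ⟨u, v, rfl⟩ := h
  exact ⟨u, fun i => B (v i), by simp [actB_sum, actB_tens]⟩

theorem SchmidtRankLE.exists_orthonormal {χ : Sys (α × β)} {k : ℕ} (h : SchmidtRankLE χ k) :
    ∃ d ≤ k, ∃ (g : Fin d → Sys α) (w : Fin d → Sys β), Orthonormal ℂ g ∧
      χ = ∑ j, tens (g j) (w j) := by
  obtain ⟨u, v, rfl⟩ := h
  let W := Submodule.span ℂ (Set.range u)
  have hW : Module.finrank ℂ W ≤ k := (finrank_range_le_card u).trans (by simp)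
  have : FiniteDimensional ℂ W := FiniteDimensional.span_of_finite ℂ (Set.finite_range u)
  let b := stdOrthonormalBasis ℂ W
  have hu : ∀ i, u i = ∑ j, b.repr ⟨u i, Submodule.subset_span ⟨i, rfl⟩⟩ j • (b j : Sys α) := by
    intro i
    have h := congrArg (Submodule.subtype W) (b.sum_repr ⟨u i, Submodule.subset_span ⟨i, rfl⟩⟩)
    rw [map_sum] at h
    exact h.symm
  refine ⟨_, hW, fun j => b j,
    fun j => ∑ i, b.repr ⟨u i, Submodule.subset_span ⟨i, rfl⟩⟩ j • v i, ?_, ?_⟩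
  · exact b.orthonormal.comp_linearIsometry W.subtypeₗᵢ
  · simp_rw [tens_sum_right, ← tens_smul_left]
    rw [Finset.sum_comm]
    refine Finset.sum_congr rfl fun i _ => ?_
    rw [← tens_sum_left, ← hu i]

theorem IsMaxEntangled.eq_smul_sum {Ψ : Sys (α × β)} {L : ℕ} (h : IsMaxEntangled Ψ L) :
    ∃ (e : Fin L → Sys α) (f : Fin L → Sys β), Orthonormal ℂ e ∧ Orthonormal ℂ f ∧
      Ψ = (((Real.sqrt L)⁻¹ : ℝ) : ℂ) • ∑ k, tens (e k) (f k) := by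
  obtain ⟨_, e, f, he, hf, h⟩ := h
  refine ⟨e, f, he, hf, ?_⟩
  ext ⟨a, b⟩
  rw [h a b, lp.coeFn_smul, Pi.smul_apply, lp.coeFn_sum, Finset.sum_apply]
  simp

theorem IsMaxEntangled.norm_eq_one {Ψ : Sys (α × β)} {L : ℕ} (h : IsMaxEntangled Ψ L) :
    ‖Ψ‖ = 1 := by
  have hL : (0 : ℝ) < L := by exact_mod_cast h.1
  obtain ⟨e, f, he, hf, rfl⟩ := h.eq_smul_sum
  have h2 := norm_sq_sum_tens he f
  simp only [hf.1, one_pow, Finset.sum_const, Finset.card_univ, Fintype.card_fin, nsmul_eq_mul,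
    mul_one] at h2
  have h3 : ‖∑ k, tens (e k) (f k)‖ = Real.sqrt L := by
    rw [← h2, Real.sqrt_sq (norm_nonneg _)]
  rw [norm_smul, h3, Complex.norm_real, Real.norm_of_nonneg (by positivity)]
  exact inv_mul_cancel₀ (Real.sqrt_pos.mpr hL).ne'

theorem IsMaxEntangled.norm_inner_sq_le {Ψ χ : Sys (α × β)} {L k : ℕ} (h : IsMaxEntangled Ψ L)
    (hχ : SchmidtRankLE χ k) : ‖inner ℂ Ψ χ‖ ^ 2 ≤ k / L * ‖χ‖ ^ 2 := by
  have hL : (0 : ℝ) < L := by exact_mod_cast h.1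
  obtain ⟨e, f, he, hf, rfl⟩ := h.eq_smul_sum
  obtain ⟨d, hd, g, w, hg, rfl⟩ := hχ.exists_orthonormal
  rw [norm_sq_sum_tens hg, inner_smul_left, norm_mul, mul_pow]
  have h1 : ‖(starRingEnd ℂ) (((Real.sqrt L)⁻¹ : ℝ) : ℂ)‖ ^ 2 = (L : ℝ)⁻¹ := by
    rw [RCLike.norm_conj, Complex.norm_real, Real.norm_of_nonneg (by positivity), inv_pow,
      Real.sq_sqrt hL.le]
  rw [h1]
  have h2 : ‖inner ℂ (∑ k, tens (e k) (f k)) (∑ j, tens (g j) (w j))‖ ^ 2 ≤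
      k * ∑ j, ‖w j‖ ^ 2 := by
    simp only [sum_inner, inner_sum, inner_tens_tens]
    rw [← Finset.sum_product' Finset.univ Finset.univ
      (fun i j => inner ℂ (e j) (g i) * inner ℂ (f j) (w i))]
    calc _ ≤ (∑ x ∈ Finset.univ ×ˢ Finset.univ,
          ‖inner ℂ (e x.2) (g x.1)‖ * ‖inner ℂ (f x.2) (w x.1)‖) ^ 2 := by
          gcongr
          refine (norm_sum_le _ _).trans (le_of_eq ?_)
          simp only [norm_mul]
      _ ≤ (∑ x ∈ Finset.univ ×ˢ Finset.univ, ‖inner ℂ (e x.2) (g x.1)‖ ^ 2) *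
          ∑ x ∈ Finset.univ ×ˢ Finset.univ, ‖inner ℂ (f x.2) (w x.1)‖ ^ 2 :=
          Finset.sum_mul_sq_le_sq_mul_sq _ _ _
      _ ≤ k * ∑ j, ‖w j‖ ^ 2 := by
          refine mul_le_mul ?_ ?_ (by positivity) (by positivity)
          · rw [Finset.sum_product]
            calc _ ≤ ∑ j : Fin d, ‖g j‖ ^ 2 :=
                  Finset.sum_le_sum fun j _ => he.sum_inner_products_le (g j)
              _ ≤ k := by simpa [hg.1] using hd
          · rw [Finset.sum_product]
            exact Finset.sum_le_sum fun j _ => hf.sum_inner_products_le (w j)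
  calc _ ≤ (L : ℝ)⁻¹ * (k * ∑ j, ‖w j‖ ^ 2) := by gcongr
    _ = _ := by ring

theorem IsMaxEntangled.le_norm_smul_sub_sq {Ψ χ : Sys (α × β)} {L k : ℕ}
    (h : IsMaxEntangled Ψ L) (hχ : SchmidtRankLE χ k) (c : ℂ) :
    ‖c‖ ^ 2 * (1 - k / L) ≤ ‖c • Ψ - χ‖ ^ 2 := by
  have h1 := h.norm_inner_sq_le hχ
  have hk : (0 : ℝ) ≤ k / L := by positivity
  rw [@norm_sub_sq ℂ, norm_smul, h.norm_eq_one, mul_one]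
  have h2 : RCLike.re (inner ℂ (c • Ψ) χ) ≤ ‖c‖ * ‖inner ℂ Ψ χ‖ := by
    refine (RCLike.re_le_norm _).trans (le_of_eq ?_)
    rw [inner_smul_left, norm_mul, RCLike.norm_conj]
  have h3 : ‖inner ℂ Ψ χ‖ ≤ Real.sqrt (k / L) * ‖χ‖ :=
    (pow_le_pow_iff_left₀ (norm_nonneg _) (by positivity) two_ne_zero).mp
      (by rwa [mul_pow, Real.sq_sqrt hk])
  have h4 := Real.sq_sqrt hk
  nlinarith [sq_nonneg (‖c‖ * Real.sqrt (k / L) - ‖χ‖), norm_nonneg c,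
    mul_le_mul_of_nonneg_left h3 (norm_nonneg c)]

end Tensor

section Converse

variable {α β α' β' : Type}

namespace LOCC

theorem final_add : {n : ℕ} → {α β : Type} → (P : LOCC α' β' n α β) → (Φ Φ' : Sys (α × β)) →
    (ω : P.Record) → P.final (Φ + Φ') ω = P.final Φ ω + P.final Φ' ω
  | _, _, _, done, _, _, _ => rfl
  | _, _, _, alice K _ next, Φ, Φ', ω => by
    change (next ω.1).final (actA (K ω.1) (Φ + Φ')) ω.2 = _
    rw [actA_add, final_add (next ω.1)]
    rfl
  | _, _, _, bob K _ next, Φ, Φ', ω => by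
    change (next ω.1).final (actB (K ω.1) (Φ + Φ')) ω.2 = _
    rw [actB_add, final_add (next ω.1)]
    rfl

theorem schmidtRankLE_final {k : ℕ} : {n : ℕ} → {α β : Type} → (P : LOCC α' β' n α β) →
    {Φ : Sys (α × β)} → SchmidtRankLE Φ k → (ω : P.Record) → SchmidtRankLE (P.final Φ ω) k
  | _, _, _, done, _, h, _ => h
  | _, _, _, alice K _ next, _, h, ω => schmidtRankLE_final (next ω.1) (h.actA (K ω.1)) ω.2
  | _, _, _, bob K _ next, _, h, ω => schmidtRankLE_final (next ω.1) (h.actB (K ω.1)) ω.2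

variable {n : ℕ}

theorem final_sum {J : Type} (P : LOCC α' β' n α β) (s : Finset J) (Φ : J → Sys (α × β))
    (ω : P.Record) : P.final (∑ j ∈ s, Φ j) ω = ∑ j ∈ s, P.final (Φ j) ω :=
  map_sum (AddMonoidHom.mk' (fun Φ => P.final Φ ω) fun Φ Φ' => P.final_add Φ Φ' ω) Φ s

theorem hasSum_inner_output (P : LOCC α' β' n α β) (Φ : Sys (α × β)) (S : Set P.Record)
    (x : Sys (α' × β')) :
    HasSum (fun ω : S => ‖inner ℂ x (P.final Φ ω)‖ ^ 2)
      (inner ℂ x (P.output Φ S x)).re := by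
  have hs : Summable fun ω : S => ketbra (P.final Φ ω) := (P.summable_final Φ).subtype S
  have h := (ContinuousLinearMap.apply ℂ (Sys (α' × β')) x).hasSum hs.hasSum
  have h2 := Complex.hasSum_re ((innerSL ℂ x).hasSum h)
  refine h2.congr_fun fun ω => ?_
  have h3 : (inner ℂ (P.final Φ ω) x * inner ℂ x (P.final Φ ω)).re = _ :=
    inner_mul_symm_re_eq_norm (𝕜 := ℂ) (P.final Φ ω) x
  simp only [ContinuousLinearMap.apply_apply, ketbra_apply, innerSL_apply_apply, inner_smul_right]
  rw [h3, norm_mul, norm_inner_symm, sq]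

/-- The total squared overlap of the final vectors with `Ψ`. -/
def overlap (P : LOCC α' β' n α β) (Ψ : Sys (α' × β')) (Φ : Sys (α × β)) : ℝ≥0∞ :=
  ∑' ω, ENNReal.ofReal (‖inner ℂ Ψ (P.final Φ ω)‖ ^ 2)

theorem overlap_le_norm_sq (P : LOCC α' β' n α β) {Ψ : Sys (α' × β')} (hΨ : ‖Ψ‖ = 1)
    (Φ : Sys (α × β)) : P.overlap Ψ Φ ≤ ENNReal.ofReal (‖Φ‖ ^ 2) := by
  rw [← P.tsum_final Φ]
  refine ENNReal.tsum_le_tsum fun ω => ENNReal.ofReal_le_ofReal ?_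
  gcongr
  simpa [hΨ] using norm_inner_le_norm (𝕜 := ℂ) Ψ (P.final Φ ω)

theorem overlap_le_of_schmidtRankLE (P : LOCC α' β' n α β) {Ψ : Sys (α' × β')} {L k : ℕ}
    (hΨ : IsMaxEntangled Ψ L) {Φ : Sys (α × β)} (hΦ : SchmidtRankLE Φ k) :
    P.overlap Ψ Φ ≤ ENNReal.ofReal (k / L * ‖Φ‖ ^ 2) := by
  rw [ENNReal.ofReal_mul (by positivity), ← P.tsum_final Φ, ← ENNReal.tsum_mul_left]
  refine ENNReal.tsum_le_tsum fun ω => ?_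
  rw [← ENNReal.ofReal_mul (by positivity)]
  exact ENNReal.ofReal_le_ofReal (hΨ.norm_inner_sq_le (P.schmidtRankLE_final hΦ ω))

theorem overlap_add_le (P : LOCC α' β' n α β) (Ψ : Sys (α' × β')) (Φ Φ' : Sys (α × β))
    {c : ℝ} (hc : 0 < c) : P.overlap Ψ (Φ + Φ') ≤
      ENNReal.ofReal (1 + 1 / c) * P.overlap Ψ Φ + ENNReal.ofReal (1 + c) * P.overlap Ψ Φ' := by
  rw [overlap, overlap, overlap, ← ENNReal.tsum_mul_left, ← ENNReal.tsum_mul_left,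
    ← ENNReal.tsum_add]
  refine ENNReal.tsum_le_tsum fun ω => ?_
  rw [← ENNReal.ofReal_mul (by positivity), ← ENNReal.ofReal_mul (by positivity),
    ← ENNReal.ofReal_add (by positivity) (by positivity)]
  refine ENNReal.ofReal_le_ofReal ?_
  rw [final_add, inner_add_right]
  set x := inner ℂ Ψ (P.final Φ ω)
  set y := inner ℂ Ψ (P.final Φ' ω)
  have h1 : ‖x + y‖ ^ 2 ≤ (‖x‖ + ‖y‖) ^ 2 := by gcongr; exact norm_add_le _ _
  have h2 : 2 * ‖x‖ * ‖y‖ ≤ 1 / c * ‖x‖ ^ 2 + c * ‖y‖ ^ 2 := by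
    have h3 : 1 / c * ‖x‖ ^ 2 + c * ‖y‖ ^ 2 - 2 * ‖x‖ * ‖y‖ = (‖x‖ - c * ‖y‖) ^ 2 / c := by
      field_simp; ring
    have h4 : 0 ≤ (‖x‖ - c * ‖y‖) ^ 2 / c := by positivity
    linarith
  nlinarith

theorem overlap_sum_le {J : Type} (P : LOCC α' β' n α β) (Ψ : Sys (α' × β')) (s : Finset J)
    (Φ : J → Sys (α × β)) :
    P.overlap Ψ (∑ j ∈ s, Φ j) ≤ s.card * ∑ j ∈ s, P.overlap Ψ (Φ j) := by
  simp only [overlap]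
  rw [← Summable.tsum_finsetSum (fun _ _ => ENNReal.summable), ← ENNReal.tsum_mul_left]
  refine ENNReal.tsum_le_tsum fun ω => ?_
  rw [← ENNReal.ofReal_sum_of_nonneg (fun _ _ => by positivity),
    ← ENNReal.ofReal_natCast, ← ENNReal.ofReal_mul (by positivity)]
  refine ENNReal.ofReal_le_ofReal ?_
  rw [final_sum, inner_sum]
  calc _ ≤ (∑ j ∈ s, ‖inner ℂ Ψ (P.final (Φ j) ω)‖) ^ 2 := by
        gcongr; exact norm_sum_le _ _
    _ ≤ _ := sq_sum_le_card_mul_sum_sq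

end LOCC

theorem DFLEC.fidelity_eq_overlap (D : DFLEC α β) (Φ : Sys (α × β)) :
    D.fidelity Φ = D.op.overlap D.target Φ := by
  have h := D.op.hasSum_inner_output Φ Set.univ D.target
  rw [DFLEC.fidelity, ← h.tsum_eq,
    ENNReal.ofReal_tsum_of_nonneg (fun _ => by positivity) h.summable, LOCC.overlap]
  exact tsum_univ fun ω => ENNReal.ofReal (‖inner ℂ D.target (D.op.final Φ ω)‖ ^ 2)

theorem DFLEC.fidelity_le_one (D : DFLEC α β) {Φ : Sys (α × β)} (hΦ : ‖Φ‖ = 1) :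
    D.fidelity Φ ≤ 1 := by
  rw [D.fidelity_eq_overlap]
  simpa [hΦ] using D.op.overlap_le_norm_sq D.target_spec.norm_eq_one Φ

theorem PFLEC.succProb_add_failProb {Φ : Sys (α × β)} (I : PFLEC Φ) (hΦ : ‖Φ‖ = 1) :
    I.succProb + I.failProb = 1 := by
  have h := I.op.tsum_final Φ
  rw [hΦ] at h
  rw [PFLEC.succProb, PFLEC.failProb, LOCC.prob, LOCC.prob]
  exact (ENNReal.summable.tsum_add_tsum_compl (s := I.success)
    (f := fun ω => ENNReal.ofReal (‖I.op.final Φ ω‖ ^ 2)) ENNReal.summable).trans (by simpa using h)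

theorem PFLEC.final_eq_smul {Φ : Sys (α × β)} (I : PFLEC Φ) {ω : I.op.Record}
    (hω : ω ∈ I.success) : I.op.final Φ ω = inner ℂ I.target (I.op.final Φ ω) • I.target := by
  have hn := I.target_spec.norm_eq_one
  set φ := I.op.final Φ ω
  set y := φ - inner ℂ I.target φ • I.target with hy
  have h0 : inner ℂ I.target y = 0 := by
    rw [hy, inner_sub_right, inner_smul_right, inner_self_eq_norm_sq_to_K, hn]; simp
  have h := I.op.hasSum_inner_output Φ I.success y
  rw [I.output_eq, _root_.smul_apply, ketbra_apply, h0] at h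
  simp only [zero_smul, smul_zero, inner_zero_right, Complex.zero_re] at h
  have h1 := congrFun ((hasSum_zero_iff_of_nonneg (fun _ => by positivity)).mp h) ⟨ω, hω⟩
  have h2 : inner ℂ y φ = 0 := by simpa using h1
  have h3 : inner ℂ y y = 0 := by
    nth_rewrite 2 [hy]
    rw [inner_sub_right, h2, inner_smul_right, ← inner_conj_symm y, h0]
    simp
  exact sub_eq_zero.mp (inner_self_eq_zero.mp h3)

/-- A probabilistic concentration, seen as a deterministic one. -/
def PFLEC.toDFLEC {Φ : Sys (α × β)} (I : PFLEC Φ) : DFLEC α β :=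
  ⟨I.outA, I.outB, I.rounds, I.op, I.size, I.target, I.target_spec⟩

theorem PFLEC.succProb_le_fidelity {Φ : Sys (α × β)} (I : PFLEC Φ) :
    I.succProb ≤ I.toDFLEC.fidelity Φ := by
  rw [DFLEC.fidelity_eq_overlap, PFLEC.succProb, LOCC.prob]
  refine le_trans (le_of_eq (tsum_congr fun ω => ?_))
    (ENNReal.tsum_comp_le_tsum_of_injective Subtype.val_injective
      fun ω => ENNReal.ofReal (‖inner ℂ I.target (I.op.final Φ ω)‖ ^ 2))
  conv_lhs => rw [I.final_eq_smul ω.2, norm_smul, I.target_spec.norm_eq_one, mul_one]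

namespace SpectralData

variable {Φ : Sys (α × β)} (Λ : SpectralData Φ)

/-- The component of `Φ` along a finite set of eigenvectors. -/
def head (s : Finset Λ.I) : Sys (α × β) := ∑ i ∈ s, tens (Λ.e i) (contr (Λ.e i) Φ)

theorem inner_contr (i j : Λ.I) [Decidable (i = j)] :
    inner ℂ (contr (Λ.e i) Φ) (contr (Λ.e j) Φ) = if i = j then (Λ.p i : ℂ) else 0 := by
  classical
  rw [inner_contr_contr, Λ.eigen, inner_smul_right, orthonormal_iff_ite.mp Λ.orthonormal]
  by_cases h : i = j
  · simp [h]
  · simp [h, Ne.symm h]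

theorem norm_contr_sq (i : Λ.I) : ‖contr (Λ.e i) Φ‖ ^ 2 = Λ.p i := by
  classical
  rw [← inner_self_eq_norm_sq (𝕜 := ℂ), Λ.inner_contr, if_pos rfl]
  simp

theorem schmidtRankLE_head (s : Finset Λ.I) : SchmidtRankLE (Λ.head s) s.card :=
  SchmidtRankLE.sum_tens s _ _

theorem norm_head_sq (s : Finset Λ.I) : ‖Λ.head s‖ ^ 2 = ∑ i ∈ s, Λ.p i := by
  have h := norm_sq_sum_tens (Λ.orthonormal.comp ((↑) : s → Λ.I) Subtype.val_injective)
    (fun i => contr (Λ.e i) Φ)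
  simp only [Function.comp_apply] at h
  rw [Finset.sum_coe_sort s fun i => tens (Λ.e i) (contr (Λ.e i) Φ),
    Finset.sum_coe_sort s fun i => ‖contr (Λ.e i) Φ‖ ^ 2] at h
  rw [head, h]
  exact Finset.sum_congr rfl fun i _ => Λ.norm_contr_sq i

theorem norm_sub_head_sq (s : Finset Λ.I) :
    ‖Φ - Λ.head s‖ ^ 2 = ‖Φ‖ ^ 2 - ∑ i ∈ s, Λ.p i := by
  have h : RCLike.re (inner ℂ Φ (Λ.head s)) = ∑ i ∈ s, Λ.p i := by
    rw [inner_re_symm, head, sum_inner, map_sum]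
    refine Finset.sum_congr rfl fun i _ => ?_
    rw [inner_tens_left, inner_self_eq_norm_sq, Λ.norm_contr_sq]
  rw [@norm_sub_sq ℂ, h, Λ.norm_head_sq]
  ring

theorem fidelity_le_two_blocks (hΦ : ‖Φ‖ = 1) (D : DFLEC α β) (s : Finset Λ.I) {c : ℝ}
    (hc : 0 < c) : D.fidelity Φ ≤ ENNReal.ofReal
      ((1 + 1 / c) * (s.card / D.size * ∑ i ∈ s, Λ.p i) + (1 + c) * (1 - ∑ i ∈ s, Λ.p i)) := by
  have h1 := D.op.overlap_add_le D.target (Λ.head s) (Φ - Λ.head s) hc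
  have h2 := D.op.overlap_le_of_schmidtRankLE D.target_spec (Λ.schmidtRankLE_head s)
  have h3 := D.op.overlap_le_norm_sq D.target_spec.norm_eq_one (Φ - Λ.head s)
  have h4 : 0 ≤ ‖Φ - Λ.head s‖ ^ 2 := by positivity
  have h5 : 0 ≤ ‖Λ.head s‖ ^ 2 := by positivity
  rw [Λ.norm_head_sq] at h2 h5
  rw [Λ.norm_sub_head_sq, hΦ, one_pow] at h3 h4
  rw [add_sub_cancel] at h1
  rw [D.fidelity_eq_overlap, ENNReal.ofReal_add (by positivity) (by positivity),
    ENNReal.ofReal_mul (by positivity : 0 ≤ 1 + 1 / c),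
    ENNReal.ofReal_mul (by positivity : 0 ≤ 1 + c)]
  exact h1.trans (by gcongr)

theorem fidelity_le_blocks (hΦ : ‖Φ‖ = 1) (D : DFLEC α β) (N : ℕ) (s : ℕ → Finset Λ.I)
    (hs : Pairwise fun i j => Disjoint (s i) (s j)) : D.fidelity Φ ≤ ENNReal.ofReal
      ((N + 1) * (∑ j ∈ Finset.range N, ((s j).card / D.size * ∑ i ∈ s j, Λ.p i) +
        (1 - ∑ j ∈ Finset.range N, ∑ i ∈ s j, Λ.p i))) := by
  classical
  let U := (Finset.range N).biUnion s
  have hdisj : Set.PairwiseDisjoint (Finset.range N : Set ℕ) s := fun i _ j _ hij => hs hij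
  have hU : Λ.head U = ∑ j ∈ Finset.range N, Λ.head (s j) := Finset.sum_biUnion hdisj
  have hpU : ∑ i ∈ U, Λ.p i = ∑ j ∈ Finset.range N, ∑ i ∈ s j, Λ.p i := Finset.sum_biUnion hdisj
  let χ : ℕ → Sys (α × β) := fun j => if j < N then Λ.head (s j) else Φ - Λ.head U
  have hχ : ∑ j ∈ Finset.range (N + 1), χ j = Φ := by
    rw [Finset.sum_range_succ, Finset.sum_congr rfl
      (fun j hj => if_pos (Finset.mem_range.mp hj) : ∀ j ∈ Finset.range N, χ j = Λ.head (s j)),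
      ← hU]
    simp [χ]
  have h1 := D.op.overlap_sum_le D.target (Finset.range (N + 1)) χ
  have h3 := D.op.overlap_le_norm_sq D.target_spec.norm_eq_one (Φ - Λ.head U)
  have h4 : 0 ≤ ‖Φ - Λ.head U‖ ^ 2 := by positivity
  rw [Λ.norm_sub_head_sq, hΦ, one_pow, hpU] at h3 h4
  have hnn : ∀ j ∈ Finset.range N, 0 ≤ ((s j).card / D.size * ∑ i ∈ s j, Λ.p i : ℝ) :=
    fun j _ => by rw [← Λ.norm_head_sq]; positivity
  rw [hχ, Finset.sum_range_succ, Finset.card_range] at h1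
  rw [D.fidelity_eq_overlap, ENNReal.ofReal_mul (by positivity),
    ENNReal.ofReal_add (Finset.sum_nonneg hnn) h4, ENNReal.ofReal_sum_of_nonneg hnn]
  refine h1.trans ?_
  have hN : ENNReal.ofReal (N + 1) = ((N + 1 : ℕ) : ℝ≥0∞) := by
    rw [← ENNReal.ofReal_natCast]; push_cast; rfl
  rw [hN]
  gcongr with j hj
  · have : χ j = Λ.head (s j) := if_pos (Finset.mem_range.mp hj)
    rw [this, ← Λ.norm_head_sq]
    exact D.op.overlap_le_of_schmidtRankLE D.target_spec (Λ.schmidtRankLE_head _)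
  · simpa [χ] using h3

theorem succProb_mul_le (hΦ : ‖Φ‖ = 1) (I : PFLEC Φ) (s : Finset Λ.I) :
    I.succProb * ENNReal.ofReal (1 - s.card / I.size) ≤
      ENNReal.ofReal (1 - ∑ i ∈ s, Λ.p i) := by
  have h1 : (1 - ∑ i ∈ s, Λ.p i) = ‖Φ - Λ.head s‖ ^ 2 := by
    rw [Λ.norm_sub_head_sq, hΦ, one_pow]
  rw [h1, ← I.op.tsum_final, PFLEC.succProb, LOCC.prob, ← ENNReal.tsum_mul_right]
  refine le_trans (ENNReal.tsum_le_tsum fun ω => ?_)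
    (ENNReal.tsum_comp_le_tsum_of_injective Subtype.val_injective
      fun ω => ENNReal.ofReal (‖I.op.final (Φ - Λ.head s) ω‖ ^ 2))
  rw [← ENNReal.ofReal_mul (by positivity)]
  refine ENNReal.ofReal_le_ofReal ?_
  have h2 := I.op.final_add (Φ - Λ.head s) (Λ.head s) ω
  rw [sub_add_cancel] at h2
  have h3 := I.target_spec.le_norm_smul_sub_sq
    (I.op.schmidtRankLE_final (Λ.schmidtRankLE_head s) ω) (inner ℂ I.target (I.op.final Φ ω))
  have h4 : ‖I.op.final Φ ω‖ = ‖inner ℂ I.target (I.op.final Φ ω)‖ := by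
    conv_lhs => rw [I.final_eq_smul ω.2, norm_smul, I.target_spec.norm_eq_one, mul_one]
  rw [← I.final_eq_smul ω.2, ← h4] at h3
  rwa [h2, add_sub_cancel_right, ← h2] at h3

end SpectralData

end Converse

section Direct

variable {α β : Type}

/-- A distribution with all weights at most `1 / M` is a mixture of uniform distributions on sets
of `M` elements. -/
theorem exists_mixture_of_uniform {N M : ℕ} (hM : 0 < M) (hMN : M ≤ N) {w : Fin N → ℝ}
    (h0 : ∀ i, 0 ≤ w i) (h1 : ∀ i, w i ≤ 1) (hw : ∑ i, w i = M) :
    ∃ t : Equiv.Perm (Fin N) → ℝ, (∀ σ, 0 ≤ t σ) ∧ ∑ σ, t σ = 1 ∧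
      ∀ g : Fin N → ℝ, ∑ σ, t σ * ∑ l : Fin M, g (σ (Fin.castLE hMN l)) = ∑ i, w i * g i := by
  have hM0 : (M : ℝ) ≠ 0 := by exact_mod_cast hM.ne'
  let D : Matrix (Fin N) (Fin N) ℝ :=
    fun r i => if (r : ℕ) < M then w i / M else (1 - w i) / (N - M)
  have hD : D ∈ doublyStochastic ℝ (Fin N) := by
    rw [mem_doublyStochastic_iff_sum]
    have hsum : ∑ i, (1 - w i) = N - M := by simp [hw]
    refine ⟨fun r i => ?_, fun r => ?_, fun i => ?_⟩
    · have hNM : (0 : ℝ) ≤ N - M := by rw [sub_nonneg]; exact_mod_cast hMN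
      have := h0 i
      have := sub_nonneg.mpr (h1 i)
      simp only [D]
      split_ifs <;> positivity
    · by_cases hr : (r : ℕ) < M
      · simp only [D, if_pos hr, ← Finset.sum_div, hw]
        exact div_self hM0
      · have : (M : ℝ) < N := by exact_mod_cast (not_lt.mp hr).trans_lt r.2
        simp only [D, if_neg hr, ← Finset.sum_div, hsum]
        exact div_self (sub_pos.mpr this).ne'
    · have hc : ({r : Fin N | (r : ℕ) < M} : Finset (Fin N)).card = M := by
        rw [Fin.card_filter_val_lt, min_eq_right hMN]
      have hc' : ({r : Fin N | ¬ (r : ℕ) < M} : Finset (Fin N)).card = N - M := by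
        have := Finset.card_filter_add_card_filter_not (s := (Finset.univ : Finset (Fin N)))
          (fun r : Fin N => (r : ℕ) < M)
        rw [hc, Finset.card_univ, Fintype.card_fin] at this
        omega
      simp only [D, Finset.sum_ite, Finset.sum_const, hc, hc', nsmul_eq_mul, Nat.cast_sub hMN]
      rw [mul_div_cancel₀ _ hM0]
      rcases hMN.eq_or_lt with h | h
      · have h2 : ∑ i, (1 - w i) = 0 := by rw [hsum, h, sub_self]
        have h3 := (Finset.sum_eq_zero_iff_of_nonneg fun i _ => sub_nonneg.mpr (h1 i)).mp h2 i
          (Finset.mem_univ i)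
        rw [h3, zero_div, mul_zero, add_zero]
        linarith
      · have : (M : ℝ) < N := by exact_mod_cast h
        rw [mul_div_cancel₀ _ (sub_pos.mpr this).ne']
        ring
  obtain ⟨t, ht0, ht1, ht⟩ := exists_eq_sum_perm_of_mem_doublyStochastic hD
  refine ⟨t, ht0, ht1, fun g => ?_⟩
  have key : ∀ l : Fin M, ∑ σ, t σ * g (σ (Fin.castLE hMN l)) = ∑ i, w i / M * g i := by
    intro l
    have h2 : ∀ i, w i / M = ∑ σ, t σ * if σ (Fin.castLE hMN l) = i then 1 else 0 := by
      intro i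
      have h3 := congrFun (congrFun ht (Fin.castLE hMN l)) i
      have h4 : D (Fin.castLE hMN l) i = w i / M := if_pos l.2
      rw [← h4, ← h3, Matrix.sum_apply]
      refine Finset.sum_congr rfl fun σ _ => ?_
      simp [Equiv.Perm.permMatrix, PEquiv.toMatrix_apply, Equiv.toPEquiv_apply, eq_comm]
    simp_rw [h2, Finset.sum_mul]
    rw [Finset.sum_comm]
    refine Finset.sum_congr rfl fun σ _ => ?_
    simp
  simp_rw [Finset.mul_sum]
  rw [Finset.sum_comm, Finset.sum_congr rfl fun l _ => key l, Finset.sum_const, Finset.card_univ,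
    Fintype.card_fin, nsmul_eq_mul, Finset.mul_sum]
  refine Finset.sum_congr rfl fun i _ => ?_
  field_simp

/-- The standard basis vectors of `Sys ℕ`. -/
def bas (k : ℕ) : Sys ℕ := lp.single 2 k 1

theorem orthonormal_bas : Orthonormal ℂ bas := by
  rw [orthonormal_iff_ite]
  intro k l
  rw [bas, bas, lp.inner_single_left, lp.single_apply]
  by_cases h : k = l
  · subst h; simp
  · simp [h]

theorem orthonormal_bas_fin (M : ℕ) : Orthonormal ℂ fun l : Fin M => bas l :=
  orthonormal_bas.comp _ Fin.val_injective

/-- The standard maximally entangled state of size `M`. -/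
def mes (M : ℕ) : Sys (ℕ × ℕ) := (((Real.sqrt M)⁻¹ : ℝ) : ℂ) • ∑ l : Fin M, tens (bas l) (bas l)

theorem isMaxEntangled_mes {M : ℕ} (hM : 0 < M) : IsMaxEntangled (mes M) M := by
  refine ⟨hM, fun l => bas l, fun l => bas l, orthonormal_bas_fin M, orthonormal_bas_fin M,
    fun a b => ?_⟩
  rw [mes, lp.coeFn_smul, Pi.smul_apply, lp.coeFn_sum, Finset.sum_apply]
  simp

theorem norm_inner_mes_sq {M L : ℕ} (hM : 0 < M) (hL : M ≤ L) :
    ‖inner ℂ (mes L) (mes M)‖ ^ 2 = M / L := by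
  have h : inner ℂ (∑ l : Fin L, tens (bas l) (bas l)) (∑ l : Fin M, tens (bas l) (bas l)) =
      (M : ℂ) := by
    rw [inner_sum]
    have : ∀ l : Fin M, inner ℂ (∑ k : Fin L, tens (bas k) (bas k)) (tens (bas l) (bas l)) =
        (1 : ℂ) := by
      intro l
      rw [sum_inner, Finset.sum_eq_single (Fin.castLE hL l)]
      · rw [inner_tens_tens, orthonormal_iff_ite.mp orthonormal_bas]; simp
      · intro k _ hk
        have : (k : ℕ) ≠ l := fun h => hk (Fin.ext h)
        rw [inner_tens_tens, orthonormal_iff_ite.mp orthonormal_bas, if_neg this, zero_mul]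
      · simp
    simp [this]
  have hM' : (0 : ℝ) < M := by exact_mod_cast hM
  have hL' : (0 : ℝ) < L := by exact_mod_cast hM.trans_le hL
  rw [mes, mes, inner_smul_left, inner_smul_right, h, norm_mul, norm_mul, RCLike.norm_conj,
    Complex.norm_real, Complex.norm_real, Complex.norm_natCast,
    Real.norm_of_nonneg (by positivity), Real.norm_of_nonneg (by positivity), mul_pow, mul_pow,
    inv_pow, inv_pow, Real.sq_sqrt hL'.le, Real.sq_sqrt hM'.le]
  field_simp

/-- The operator `∑ l, c l |l⟩⟨u l|`. -/
def relabel {M : ℕ} (u : Fin M → Sys α) (c : Fin M → ℝ) : Sys α →L[ℂ] Sys ℕ :=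
  ∑ l, (c l : ℂ) • InnerProductSpace.rankOne ℂ (bas l) (u l)

theorem relabel_apply {M : ℕ} (u : Fin M → Sys α) (c : Fin M → ℝ) (x : Sys α) :
    relabel u c x = ∑ l, ((c l : ℂ) * inner ℂ (u l) x) • bas l := by
  simp only [relabel, _root_.sum_apply, _root_.smul_apply, InnerProductSpace.rankOne_apply,
    smul_smul]

theorem norm_relabel_sq {M : ℕ} (u : Fin M → Sys α) (c : Fin M → ℝ) (x : Sys α) :
    ‖relabel u c x‖ ^ 2 = ∑ l, c l ^ 2 * ‖inner ℂ (u l) x‖ ^ 2 := by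
  rw [relabel_apply, ← inner_self_eq_norm_sq (𝕜 := ℂ),
    (orthonormal_bas_fin M).inner_sum, map_sum]
  refine Finset.sum_congr rfl fun l _ => ?_
  rw [RCLike.conj_mul, ← RCLike.ofReal_pow, RCLike.ofReal_re, norm_mul, mul_pow,
    Complex.norm_real, Real.norm_eq_abs, sq_abs]

theorem relabel_one_apply {M : ℕ} {u : Fin M → Sys α} (hu : Orthonormal ℂ u) (l : Fin M) :
    relabel u (fun _ => 1) (u l) = bas l := by
  rw [relabel_apply, Finset.sum_eq_single l]
  · simp [inner_self_eq_norm_sq_to_K, hu.1 l]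
  · intro k _ hk
    rw [hu.2 hk, mul_zero, zero_smul]
  · simp

/-- The measurement outcomes that cover the orthogonal complement of an orthonormal system. -/
def discard {N : ℕ} (u : Fin N → Sys α) (a : α) : Sys α →L[ℂ] Sys ℕ :=
  ((lp.evalCLM ℂ (fun _ : α => ℂ) 2 a).smulRight (bas 0)).comp
    (ContinuousLinearMap.id ℂ _ - ∑ k, ketbra (u k))

theorem norm_sub_sum_inner_smul_sq {N : ℕ} {u : Fin N → Sys α} (hu : Orthonormal ℂ u)
    (x : Sys α) : ‖x - ∑ k, inner ℂ (u k) x • u k‖ ^ 2 =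
      ‖x‖ ^ 2 - ∑ k, ‖inner ℂ (u k) x‖ ^ 2 := by
  have h1 : ‖∑ k, inner ℂ (u k) x • u k‖ ^ 2 = ∑ k, ‖inner ℂ (u k) x‖ ^ 2 := by
    rw [← inner_self_eq_norm_sq (𝕜 := ℂ), hu.inner_sum, map_sum]
    refine Finset.sum_congr rfl fun l _ => ?_
    rw [RCLike.conj_mul, ← RCLike.ofReal_pow, RCLike.ofReal_re]
  have h2 : RCLike.re (inner ℂ x (∑ k, inner ℂ (u k) x • u k)) =
      ∑ k, ‖inner ℂ (u k) x‖ ^ 2 := by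
    rw [inner_sum, map_sum]
    refine Finset.sum_congr rfl fun l _ => ?_
    rw [inner_smul_right, inner_mul_symm_re_eq_norm, norm_mul, norm_inner_symm x, sq]
  rw [@norm_sub_sq ℂ, h1, h2]
  ring

theorem hasSum_norm_discard_sq {N : ℕ} {u : Fin N → Sys α} (hu : Orthonormal ℂ u) (x : Sys α) :
    HasSum (fun a => ‖discard u a x‖ ^ 2) (‖x‖ ^ 2 - ∑ k, ‖inner ℂ (u k) x‖ ^ 2) := by
  have h1 : ∀ a, discard u a x = (x - ∑ k, inner ℂ (u k) x • u k : Sys α) a • bas 0 := by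
    intro a
    have h2 : (ContinuousLinearMap.id ℂ (Sys α) - ∑ k, ketbra (u k) : Sys α →L[ℂ] Sys α) x =
        x - ∑ k, inner ℂ (u k) x • u k := by
      simp only [_root_.sub_apply, _root_.sum_apply, ketbra_apply, ContinuousLinearMap.id_apply]
    rw [discard, ContinuousLinearMap.comp_apply, h2]
    rfl
  rw [← norm_sub_sum_inner_smul_sq hu, norm_sq_eq]
  refine (summable_sq _).hasSum.congr_fun fun a => ?_
  rw [h1, norm_smul, orthonormal_bas.1, mul_one]

theorem isMeasurement_sumElim {N : ℕ} {J : Type} [Fintype J] {u : Fin N → Sys α}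
    (hu : Orthonormal ℂ u) {K : J → Sys α →L[ℂ] Sys ℕ}
    (hK : ∀ x, ∑ j, ‖K j x‖ ^ 2 = ∑ k, ‖inner ℂ (u k) x‖ ^ 2) :
    IsMeasurement (Sum.elim K (discard u)) := by
  intro x
  have h1 : HasSum (fun j => ‖K j x‖ ^ 2) (∑ k, ‖inner ℂ (u k) x‖ ^ 2) := by
    rw [← hK x]; exact hasSum_fintype _
  have h := HasSum.sum (f := fun j => ‖Sum.elim K (discard u) j x‖ ^ 2) h1
    (hasSum_norm_discard_sq hu x)
  simpa using h

theorem smul_tens (c : ℂ) (u : Sys α) (v : Sys β) : c • tens u v = tens (c • u) v := by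
  ext p
  simp [mul_assoc]

theorem actA_relabel {M : ℕ} (u : Fin M → Sys α) (c : Fin M → ℝ) (Φ : Sys (α × β)) :
    actA (relabel u c) Φ = ∑ l, (c l : ℂ) • tens (bas l) (contr (u l) Φ) := by
  ext p
  rw [actA_apply, relabel_apply, lp.coeFn_sum, lp.coeFn_sum, Finset.sum_apply, Finset.sum_apply]
  refine Finset.sum_congr rfl fun l _ => ?_
  simp only [lp.coeFn_smul, Pi.smul_apply, smul_eq_mul, tens_apply, contr_apply]
  ring


namespace SpectralData

variable {Φ : Sys (α × β)} (Λ : SpectralData Φ)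

/-- The Schmidt vectors of the second system. -/
def schmidtB (i : Λ.I) : Sys β := (((Real.sqrt (Λ.p i))⁻¹ : ℝ) : ℂ) • contr (Λ.e i) Φ

theorem contr_eq_smul_schmidtB (i : Λ.I) :
    contr (Λ.e i) Φ = ((Real.sqrt (Λ.p i) : ℝ) : ℂ) • Λ.schmidtB i := by
  have h : Real.sqrt (Λ.p i) ≠ 0 := (Real.sqrt_pos.mpr (Λ.pos i)).ne'
  rw [schmidtB, smul_smul, ← Complex.ofReal_mul, mul_inv_cancel₀ h, Complex.ofReal_one, one_smul]

theorem orthonormal_schmidtB : Orthonormal ℂ Λ.schmidtB := by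
  classical
  rw [orthonormal_iff_ite]
  intro i j
  rw [schmidtB, schmidtB, inner_smul_left, inner_smul_right, Λ.inner_contr]
  by_cases h : i = j
  · subst h
    have h1 : Real.sqrt (Λ.p i) ≠ 0 := (Real.sqrt_pos.mpr (Λ.pos i)).ne'
    have h2 := Real.mul_self_sqrt (Λ.pos i).le
    rw [if_pos rfl, if_pos rfl, Complex.conj_ofReal, ← Complex.ofReal_mul, ← Complex.ofReal_mul,
      ← Complex.ofReal_one]
    congr 1
    rw [← mul_assoc, ← mul_inv, h2, inv_mul_cancel₀ (Λ.pos i).ne']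
  · simp [h]

theorem exists_protocol_fin {N M : ℕ} (hM : 0 < M) (q : Fin N → Λ.I)
    (hq : Function.Injective q) (hp : ∀ i, M * Λ.p (q i) ≤ ∑ k, Λ.p (q k)) (hN : 0 < N) :
    ∃ (P : LOCC ℕ ℕ 2 α β) (S : Set P.Record),
      P.prob Φ S = ENNReal.ofReal (∑ k, Λ.p (q k)) ∧
        ∀ ω ∈ S, ∃ c : ℂ, P.final Φ ω = c • mes M := by
  set m := ∑ k, Λ.p (q k) with hm
  have hm0 : 0 < m := Finset.sum_pos (fun k _ => Λ.pos _) ⟨⟨0, hN⟩, Finset.mem_univ _⟩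
  have hM' : (0 : ℝ) < M := by exact_mod_cast hM
  have hMN : M ≤ N := by
    have h : ∑ i, M * Λ.p (q i) ≤ ∑ _i : Fin N, m := Finset.sum_le_sum fun i _ => hp i
    rw [← Finset.mul_sum, ← hm, Finset.sum_const, Finset.card_univ, Fintype.card_fin,
      nsmul_eq_mul] at h
    exact_mod_cast le_of_mul_le_mul_right h hm0
  let w : Fin N → ℝ := fun i => M * Λ.p (q i) / m
  have hw0 : ∀ i, 0 < w i := fun i => div_pos (mul_pos hM' (Λ.pos _)) hm0
  obtain ⟨t, ht0, ht1, ht⟩ := exists_mixture_of_uniform hM hMN (w := w) (fun i => (hw0 i).le)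
    (fun i => (div_le_one hm0).mpr (hp i)) (by
      simp only [w]
      rw [← Finset.sum_div, ← Finset.mul_sum, ← hm, mul_div_assoc, div_self hm0.ne', mul_one])
  let pick : Equiv.Perm (Fin N) → Fin M → Fin N := fun σ l => σ (Fin.castLE hMN l)
  have hpick : ∀ σ, Function.Injective (pick σ) := fun σ =>
    σ.injective.comp (Fin.castLE_injective hMN)
  have he : Orthonormal ℂ fun k => Λ.e (q k) := Λ.orthonormal.comp q hq
  have hf : ∀ σ, Orthonormal ℂ fun l => Λ.schmidtB (q (pick σ l)) := fun σ =>
    Λ.orthonormal_schmidtB.comp _ (hq.comp (hpick σ))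
  let K : Equiv.Perm (Fin N) → Sys α →L[ℂ] Sys ℕ := fun σ =>
    relabel (fun l => Λ.e (q (pick σ l))) fun l => Real.sqrt (t σ / w (pick σ l))
  have hK : IsMeasurement (Sum.elim K (discard fun k => Λ.e (q k))) := by
    refine isMeasurement_sumElim he fun x => ?_
    have h := ht fun k => ‖inner ℂ (Λ.e (q k)) x‖ ^ 2 / w k
    have h2 : ∀ k, w k * (‖inner ℂ (Λ.e (q k)) x‖ ^ 2 / w k) = ‖inner ℂ (Λ.e (q k)) x‖ ^ 2 :=
      fun k => mul_div_cancel₀ _ (hw0 k).ne'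
    rw [Finset.sum_congr rfl fun k _ => h2 k] at h
    rw [← h]
    refine Finset.sum_congr rfl fun σ _ => ?_
    rw [norm_relabel_sq, Finset.mul_sum]
    refine Finset.sum_congr rfl fun l _ => ?_
    rw [Real.sq_sqrt (div_nonneg (ht0 σ) (hw0 _).le)]
    simp only [pick]
    ring
  let V : Equiv.Perm (Fin N) → Unit ⊕ β → Sys β →L[ℂ] Sys ℕ := fun σ =>
    Sum.elim (fun _ => relabel (fun l => Λ.schmidtB (q (pick σ l))) fun _ => 1)
      (discard fun l => Λ.schmidtB (q (pick σ l)))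
  have hV : ∀ σ, IsMeasurement (V σ) := fun σ =>
    isMeasurement_sumElim (hf σ) fun x => by simp [norm_relabel_sq]
  let perm : Equiv.Perm (Fin N) ⊕ α → Equiv.Perm (Fin N) := Sum.elim id fun _ => 1
  let P : LOCC ℕ ℕ 2 α β := LOCC.alice _ hK fun j =>
    LOCC.bob (V (perm j)) (hV (perm j)) fun _ => LOCC.done
  let record : Equiv.Perm (Fin N) → P.Record := fun σ => ⟨Sum.inl σ, Sum.inl (), ()⟩
  have hrec : Function.Injective record := fun σ τ h =>
    Sum.inl_injective (congrArg Sigma.fst h)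
  have hfinal : ∀ σ, P.final Φ (record σ) = ((Real.sqrt (t σ * m) : ℝ) : ℂ) • mes M := by
    intro σ
    have h1 : P.final Φ (record σ) =
        actB (relabel (fun l => Λ.schmidtB (q (pick σ l))) fun _ => 1) (actA (K σ) Φ) := rfl
    rw [h1, actA_relabel, actB_sum, mes, smul_smul, Finset.smul_sum]
    refine Finset.sum_congr rfl fun l => fun _ => ?_
    have h2 : relabel (fun l => Λ.schmidtB (q (pick σ l))) (fun _ => 1)
        (Λ.schmidtB (q (pick σ l))) = bas l := relabel_one_apply (hf σ) l
    rw [Λ.contr_eq_smul_schmidtB, ← tens_smul_left, smul_tens, actB_tens, h2, smul_smul,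
      ← smul_tens, ← Complex.ofReal_mul, ← Complex.ofReal_mul]
    congr 2
    rw [← Real.sqrt_mul (div_nonneg (ht0 σ) (hw0 _).le), ← Real.sqrt_inv,
      ← Real.sqrt_mul (mul_nonneg (ht0 σ) hm0.le)]
    congr 1
    have h3 := (Λ.pos (q (pick σ l))).ne'
    simp only [w]
    field_simp
  refine ⟨P, Set.range record, ?_, ?_⟩
  · rw [LOCC.prob, tsum_range (fun ω => ENNReal.ofReal (‖P.final Φ ω‖ ^ 2)) hrec, tsum_fintype]
    have h : ∀ σ, ‖P.final Φ (record σ)‖ ^ 2 = t σ * m := fun σ => by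
      rw [hfinal, norm_smul, (isMaxEntangled_mes hM).norm_eq_one, mul_one, Complex.norm_real,
        Real.norm_of_nonneg (by positivity), Real.sq_sqrt (mul_nonneg (ht0 σ) hm0.le)]
    simp_rw [h]
    rw [← ENNReal.ofReal_sum_of_nonneg fun σ _ => mul_nonneg (ht0 σ) hm0.le, ← Finset.sum_mul,
      ht1, one_mul]
  · rintro _ ⟨σ, rfl⟩
    exact ⟨_, hfinal σ⟩

theorem exists_protocol {M : ℕ} (hM : 0 < M) {s : Finset Λ.I} (hs : s.Nonempty)
    (hp : ∀ i ∈ s, M * Λ.p i ≤ ∑ k ∈ s, Λ.p k) :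
    ∃ (P : LOCC ℕ ℕ 2 α β) (S : Set P.Record), P.prob Φ S = ENNReal.ofReal (∑ k ∈ s, Λ.p k) ∧
      ∀ ω ∈ S, ∃ c : ℂ, P.final Φ ω = c • mes M := by
  have h : ∑ k, Λ.p (s.equivFin.symm k) = ∑ k ∈ s, Λ.p k := by
    rw [s.equivFin.symm.sum_comp fun i : s => Λ.p i, Finset.sum_coe_sort s Λ.p]
  rw [← h] at hp ⊢
  exact Λ.exists_protocol_fin hM (fun k => s.equivFin.symm k)
    (Subtype.val_injective.comp s.equivFin.symm.injective)
    (fun i => hp _ (s.equivFin.symm i).2) (Finset.card_pos.mpr hs)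

end SpectralData

theorem ketbra_smul (c : ℂ) (x : Sys α) : ketbra (c • x) = (‖c‖ ^ 2) • ketbra x := by
  ext1 y
  rw [ketbra_apply, _root_.smul_apply, ketbra_apply, inner_smul_left, smul_smul,
    mul_right_comm, RCLike.conj_mul, mul_smul]
  norm_cast

theorem LOCC.output_eq_of_forall_smul {n : ℕ} {α' β' : Type} (P : LOCC α' β' n α β)
    {Φ : Sys (α × β)} {S : Set P.Record} {Ψ : Sys (α' × β')} (hΨ : ‖Ψ‖ = 1)
    (h : ∀ ω ∈ S, ∃ c : ℂ, P.final Φ ω = c • Ψ) :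
    P.output Φ S = (P.prob Φ S).toReal • ketbra Ψ := by
  choose! c hc using h
  have h1 : ∀ ω : S, ketbra (P.final Φ ω) = (‖P.final Φ ω‖ ^ 2) • ketbra Ψ := fun ω => by
    rw [hc ω ω.2, ketbra_smul, norm_smul, hΨ, mul_one]
  have hs : Summable fun ω : S => ‖P.final Φ ω‖ ^ 2 := by
    have h2 := ENNReal.summable_toReal (f := fun ω => ENNReal.ofReal (‖P.final Φ ω‖ ^ 2))
      (by rw [P.tsum_final]; exact ENNReal.ofReal_ne_top)
    refine (h2.subtype S).congr fun ω => ?_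
    exact ENNReal.toReal_ofReal (sq_nonneg _)
  rw [LOCC.output, tsum_congr h1, hs.tsum_smul_const, LOCC.prob,
    ← ENNReal.ofReal_tsum_of_nonneg (fun _ => by positivity) hs,
    ENNReal.toReal_ofReal (tsum_nonneg fun _ => by positivity)]

namespace SpectralData

variable {Φ : Sys (α × β)} (Λ : SpectralData Φ)

theorem exists_pflec {M : ℕ} (hM : 0 < M) {s : Finset Λ.I} (hs : s.Nonempty)
    (hp : ∀ i ∈ s, M * Λ.p i ≤ ∑ k ∈ s, Λ.p k) :
    ∃ I : PFLEC Φ, I.size = M ∧ I.succProb = ENNReal.ofReal (∑ k ∈ s, Λ.p k) := by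
  obtain ⟨P, S, h1, h2⟩ := Λ.exists_protocol hM hs hp
  exact ⟨⟨ℕ, ℕ, 2, P, S, M, mes M, isMaxEntangled_mes hM,
    P.output_eq_of_forall_smul (isMaxEntangled_mes hM).norm_eq_one h2⟩, rfl, h1⟩

theorem exists_dflec {M L : ℕ} (hM : 0 < M) (hL : M ≤ L) {s : Finset Λ.I} (hs : s.Nonempty)
    (hp : ∀ i ∈ s, M * Λ.p i ≤ ∑ k ∈ s, Λ.p k) :
    ∃ D : DFLEC α β, D.size = L ∧
      ENNReal.ofReal (M / L * ∑ k ∈ s, Λ.p k) ≤ D.fidelity Φ := by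
  obtain ⟨P, S, h1, h2⟩ := Λ.exists_protocol hM hs hp
  refine ⟨⟨ℕ, ℕ, 2, P, L, mes L, isMaxEntangled_mes (hM.trans_le hL)⟩, rfl, ?_⟩
  rw [DFLEC.fidelity_eq_overlap, ENNReal.ofReal_mul (by positivity), ← h1, LOCC.prob,
    ← ENNReal.tsum_mul_left]
  refine le_trans (le_of_eq (tsum_congr fun ω => ?_))
    (ENNReal.tsum_comp_le_tsum_of_injective Subtype.val_injective
      fun ω => ENNReal.ofReal (‖inner ℂ (mes L) (P.final Φ ω)‖ ^ 2))
  obtain ⟨c, hc⟩ := h2 ω ω.2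
  rw [← ENNReal.ofReal_mul (by positivity), hc, inner_smul_right, norm_smul, norm_mul,
    (isMaxEntangled_mes hM).norm_eq_one, mul_one, mul_pow, norm_inner_mes_sq hM hL, mul_comm]

end SpectralData

theorem exists_pflec_size {Φ : Sys (α × β)} (hΦ : ‖Φ‖ = 1) {M : ℕ} (hM : 0 < M) :
    ∃ I : PFLEC Φ, I.size = M := by
  obtain ⟨Λ⟩ := nonempty_spectralData Φ
  have hne : Nonempty Λ.I := by
    by_contra h
    rw [not_nonempty_iff] at h
    have := Λ.tsum_eq
    simp [hΦ] at this
  obtain ⟨i⟩ := hne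
  obtain ⟨P, S, -⟩ := Λ.exists_protocol one_pos (Finset.singleton_nonempty i) (by simp)
  exact ⟨⟨ℕ, ℕ, 2, P, ∅, M, mes M, isMaxEntangled_mes hM,
    P.output_eq_of_forall_smul (isMaxEntangled_mes hM).norm_eq_one (by simp)⟩, rfl⟩

end Direct

section OneShot

variable {α β : Type}

theorem specMass_univ {Φ : Sys (α × β)} (hΦ : ‖Φ‖ = 1) :
    specMass (reduced Φ) Set.univ = 1 := by
  obtain ⟨Λ⟩ := nonempty_spectralData Φ
  rw [Λ.specMass_eq]
  simpa [hΦ] using Λ.tsum_eq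

theorem specMass_mono (Φ : Sys (α × β)) {S S' : Set ℝ} (h : S ⊆ S') :
    specMass (reduced Φ) S ≤ specMass (reduced Φ) S' := by
  obtain ⟨Λ⟩ := nonempty_spectralData Φ
  rw [Λ.specMass_eq, Λ.specMass_eq]
  refine ENNReal.tsum_le_tsum fun i => ?_
  exact Set.indicator_le_indicator_of_subset (Set.preimage_mono h) (fun _ => zero_le) i

theorem specMass_le_one {Φ : Sys (α × β)} (hΦ : ‖Φ‖ = 1) (S : Set ℝ) :
    specMass (reduced Φ) S ≤ 1 :=
  (specMass_mono Φ (Set.subset_univ S)).trans_eq (specMass_univ hΦ)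

theorem specMass_ne_top {Φ : Sys (α × β)} (hΦ : ‖Φ‖ = 1) (S : Set ℝ) :
    specMass (reduced Φ) S ≠ ⊤ := ne_top_of_le_ne_top ENNReal.one_ne_top (specMass_le_one hΦ S)

theorem specMass_union (Φ : Sys (α × β)) {S S' : Set ℝ} (h : Disjoint S S') :
    specMass (reduced Φ) (S ∪ S') = specMass (reduced Φ) S + specMass (reduced Φ) S' := by
  obtain ⟨Λ⟩ := nonempty_spectralData Φ
  rw [Λ.specMass_eq, Λ.specMass_eq, Λ.specMass_eq, ← ENNReal.tsum_add, Set.preimage_union]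
  refine tsum_congr fun i => ?_
  rw [Set.indicator_union_of_disjoint (h.preimage Λ.p)]

namespace SpectralData

variable {Φ : Sys (α × β)} (Λ : SpectralData Φ)

theorem ofReal_sum_le_specMass {S : Set ℝ} {s : Finset Λ.I} (hs : ∀ i ∈ s, Λ.p i ∈ S) :
    ENNReal.ofReal (∑ i ∈ s, Λ.p i) ≤ specMass (reduced Φ) S := by
  rw [Λ.specMass_eq, ENNReal.ofReal_sum_of_nonneg fun i _ => (Λ.pos i).le]
  refine le_trans (le_of_eq (Finset.sum_congr rfl fun i hi => ?_)) (ENNReal.sum_le_tsum s)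
  exact (Set.indicator_of_mem (hs i hi) _).symm

theorem sum_le_one (hΦ : ‖Φ‖ = 1) (s : Finset Λ.I) : ∑ i ∈ s, Λ.p i ≤ 1 := by
  have h := (Λ.ofReal_sum_le_specMass (S := Set.univ) (s := s) fun _ _ => trivial).trans_eq
    (specMass_univ hΦ)
  rwa [ENNReal.ofReal_le_one] at h

theorem exists_lt_sum {S : Set ℝ} {t : ℝ} (ht : 0 ≤ t)
    (h : ENNReal.ofReal t < specMass (reduced Φ) S) :
    ∃ s : Finset Λ.I, (∀ i ∈ s, Λ.p i ∈ S) ∧ t < ∑ i ∈ s, Λ.p i := by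
  classical
  rw [Λ.specMass_eq, ENNReal.tsum_eq_iSup_sum, lt_iSup_iff] at h
  obtain ⟨s, hs⟩ := h
  refine ⟨s.filter fun i => Λ.p i ∈ S, fun i hi => (Finset.mem_filter.mp hi).2, ?_⟩
  have h1 : ∑ i ∈ s, (Λ.p ⁻¹' S).indicator (fun i => ENNReal.ofReal (Λ.p i)) i =
      ENNReal.ofReal (∑ i ∈ s.filter fun i => Λ.p i ∈ S, Λ.p i) := by
    rw [ENNReal.ofReal_sum_of_nonneg fun i _ => (Λ.pos i).le, Finset.sum_filter]
    exact Finset.sum_congr rfl fun i _ => by simp [Set.indicator]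
  rw [h1] at hs
  exact (ENNReal.ofReal_lt_ofReal_iff_of_nonneg ht).mp hs

theorem exists_finset_of_subset_Ici (hΦ : ‖Φ‖ = 1) {x : ℝ} (hx : 0 < x) {S : Set ℝ}
    (hS : S ⊆ Set.Ici x) : ∃ s : Finset Λ.I, (∀ i, i ∈ s ↔ Λ.p i ∈ S) ∧
      ENNReal.ofReal (∑ i ∈ s, Λ.p i) = specMass (reduced Φ) S ∧
      s.card * x ≤ ∑ i ∈ s, Λ.p i := by
  have hcard : ∀ s : Finset Λ.I, (∀ i ∈ s, Λ.p i ∈ S) → s.card * x ≤ ∑ i ∈ s, Λ.p i := by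
    intro s hs
    rw [← nsmul_eq_mul]
    exact Finset.card_nsmul_le_sum s _ _ fun i hi => hS (hs i hi)
  have hfin : (Λ.p ⁻¹' S).Finite := by
    by_contra hinf
    obtain ⟨k, hk⟩ := exists_nat_gt (1 / x)
    obtain ⟨s, hs, hsk⟩ := (show (Λ.p ⁻¹' S).Infinite from hinf).exists_subset_card_eq k
    have h1 := (hcard s fun i hi => hs hi).trans (Λ.sum_le_one hΦ s)
    rw [hsk, ← le_div_iff₀ hx] at h1
    linarith
  refine ⟨hfin.toFinset, fun i => by simp, ?_,
    hcard _ fun i hi => hfin.mem_toFinset.mp hi⟩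
  rw [Λ.specMass_eq, ENNReal.ofReal_sum_of_nonneg fun i _ => (Λ.pos i).le,
    tsum_eq_sum (s := hfin.toFinset)]
  · exact Finset.sum_congr rfl fun i hi => by
      rw [Set.indicator_of_mem (hfin.mem_toFinset.mp hi)]
  · intro i hi
    exact Set.indicator_of_notMem (fun h => hi (hfin.mem_toFinset.mpr h)) _

end SpectralData

theorem specMass_Iio_eq_one {Φ : Sys (α × β)} (hΦ : ‖Φ‖ = 1) {y : ℝ} (hy : 1 < y) :
    specMass (reduced Φ) (Set.Iio y) = 1 := by
  obtain ⟨Λ⟩ := nonempty_spectralData Φ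
  have h := Λ.tsum_eq
  rw [hΦ, one_pow, ENNReal.ofReal_one] at h
  rw [Λ.specMass_eq, ← h]
  refine tsum_congr fun i => Set.indicator_of_mem ?_ _
  have h1 := Λ.sum_le_one hΦ {i}
  rw [Finset.sum_singleton] at h1
  exact h1.trans_lt hy

theorem toReal_specMass_le_one {Φ : Sys (α × β)} (hΦ : ‖Φ‖ = 1) (S : Set ℝ) :
    (specMass (reduced Φ) S).toReal ≤ 1 :=
  ENNReal.toReal_le_of_le_ofReal zero_le_one (by simpa using specMass_le_one hΦ S)

theorem toReal_specMass_add_compl {Φ : Sys (α × β)} (hΦ : ‖Φ‖ = 1) (S : Set ℝ) :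
    (specMass (reduced Φ) S).toReal + (specMass (reduced Φ) Sᶜ).toReal = 1 := by
  rw [← ENNReal.toReal_add (specMass_ne_top hΦ _) (specMass_ne_top hΦ _),
    ← specMass_union Φ disjoint_compl_right, Set.union_compl_self, specMass_univ hΦ,
    ENNReal.toReal_one]

theorem specMass_mul_add_fidelity_le {Φ : Sys (α × β)} (hΦ : ‖Φ‖ = 1) (D : DFLEC α β) {x θ : ℝ}
    (hx : 0 < x) (hθ : 0 < θ) (h : 1 ≤ θ ^ 2 * (x * D.size)) {S : Set ℝ} (hS : S ⊆ Set.Ici x) :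
    (specMass (reduced Φ) S).toReal * (1 - 2 * θ - θ ^ 2) + (D.fidelity Φ).toReal ≤ 1 := by
  obtain ⟨Λ⟩ := nonempty_spectralData Φ
  have hL : (0 : ℝ) < D.size := by exact_mod_cast D.target_spec.1
  obtain ⟨s, -, hs, hcard⟩ := Λ.exists_finset_of_subset_Ici hΦ hx hS
  have hm0 : 0 ≤ ∑ i ∈ s, Λ.p i := Finset.sum_nonneg fun i _ => (Λ.pos i).le
  rw [← hs, ENNReal.toReal_ofReal hm0]
  have hm1 := Λ.sum_le_one hΦ s
  have hF := fun c hc => Λ.fidelity_le_two_blocks hΦ D s (c := c) hc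
  set m := ∑ i ∈ s, Λ.p i
  rcases hm0.eq_or_lt with h0 | h0
  · rw [← h0, zero_mul, zero_add]
    exact ENNReal.toReal_le_of_le_ofReal zero_le_one (by simpa using D.fidelity_le_one hΦ)
  · have hk : s.card / D.size ≤ θ ^ 2 * m := by
      rw [div_le_iff₀ hL]
      have h1 : (s.card : ℝ) * 1 ≤ s.card * (θ ^ 2 * (x * D.size)) := by gcongr
      have h2 : s.card * x * (θ ^ 2 * D.size) ≤ m * (θ ^ 2 * D.size) := by gcongr
      linarith
    have hc : 0 < θ * m := mul_pos hθ h0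
    have h3 := ENNReal.toReal_le_of_le_ofReal (by
      have : 0 ≤ 1 - m := by linarith
      positivity) (hF _ hc)
    have h4 : (1 + 1 / (θ * m)) * (s.card / D.size * m) ≤
        (1 + 1 / (θ * m)) * (θ ^ 2 * m * m) := by gcongr
    have h5 : (1 + 1 / (θ * m)) * (θ ^ 2 * m * m) = θ ^ 2 * m ^ 2 + θ * m := by
      field_simp
    nlinarith [mul_nonneg (sq_nonneg θ) (mul_nonneg hm0 (sub_nonneg.mpr hm1)),
      mul_nonneg hθ.le (mul_nonneg hm0 hm0)]

theorem SpectralData.exists_blocks {Φ : Sys (α × β)} (Λ : SpectralData Φ) (hΦ : ‖Φ‖ = 1)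
    {y : ℕ → ℝ} (hy : Antitone y) (hpos : ∀ j, 0 < y j) (hy0 : 1 < y 0) :
    ∃ s : ℕ → Finset Λ.I, (Pairwise fun i j => Disjoint (s i) (s j)) ∧
      (∀ j, ∑ i ∈ s j, Λ.p i ≤ (specMass (reduced Φ) (Set.Iio (y j))).toReal) ∧
      (∀ j, ((s j).card : ℝ) ≤ (specMass (reduced Φ) (Set.Iio (y j))).toReal / y (j + 1)) ∧
      ∀ N, 1 - ∑ j ∈ Finset.range N, ∑ i ∈ s j, Λ.p i ≤
        (specMass (reduced Φ) (Set.Iio (y N))).toReal := by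
  have h : ∀ j, ∃ s : Finset Λ.I, (∀ i, i ∈ s ↔ Λ.p i ∈ Set.Ico (y (j + 1)) (y j)) ∧
      ENNReal.ofReal (∑ i ∈ s, Λ.p i) =
        specMass (reduced Φ) (Set.Ico (y (j + 1)) (y j)) ∧
      s.card * y (j + 1) ≤ ∑ i ∈ s, Λ.p i := fun j =>
    Λ.exists_finset_of_subset_Ici hΦ (hpos (j + 1)) Set.Ico_subset_Ici_self
  choose s hmem hsum hcard using h
  have hle : ∀ j, ∑ i ∈ s j, Λ.p i ≤ (specMass (reduced Φ) (Set.Iio (y j))).toReal := fun j => by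
    rw [← ENNReal.ofReal_le_iff_le_toReal (specMass_ne_top hΦ _), hsum]
    exact specMass_mono Φ Set.Ico_subset_Iio_self
  refine ⟨s, ?_, hle, fun j => ?_, fun N => ?_⟩
  · have key : ∀ i j, i < j → Disjoint (s i) (s j) := fun i j hij => by
      rw [Finset.disjoint_left]
      intro k hi hj
      rw [hmem] at hi hj
      exact absurd (hj.2.trans_le (hy hij)) (not_lt.mpr hi.1)
    intro i j hij
    rcases lt_or_gt_of_ne hij with h | h
    · exact key i j h
    · exact (key j i h).symm
  · rw [le_div_iff₀ (hpos _)]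
    exact (hcard j).trans (hle j)
  · have hm : ∀ j, ∑ i ∈ s j, Λ.p i =
        (specMass (reduced Φ) (Set.Ico (y (j + 1)) (y j))).toReal := fun j => by
      rw [← hsum, ENNReal.toReal_ofReal (Finset.sum_nonneg fun i _ => (Λ.pos i).le)]
    induction N with
    | zero =>
      simp [specMass_Iio_eq_one hΦ hy0]
    | succ N ih =>
      have hu : Set.Iio (y N) = Set.Iio (y (N + 1)) ∪ Set.Ico (y (N + 1)) (y N) :=
        (Set.Iio_union_Ico_eq_Iio (hy N.le_succ)).symm
      have hd : Disjoint (Set.Iio (y (N + 1))) (Set.Ico (y (N + 1)) (y N)) :=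
        Set.disjoint_left.mpr fun z hz hz' => absurd hz (not_lt.mpr hz'.1)
      rw [hu, specMass_union Φ hd, ENNReal.toReal_add (specMass_ne_top hΦ _)
        (specMass_ne_top hΦ _), ← hm N] at ih
      rw [Finset.sum_range_succ]
      linarith

theorem fidelity_le_grid {Φ : Sys (α × β)} (hΦ : ‖Φ‖ = 1) (D : DFLEC α β)
    {y : ℕ → ℝ} (hy : Antitone y) (hpos : ∀ j, 0 < y j) (hy0 : 1 < y 0) (N : ℕ) :
    D.fidelity Φ ≤ ENNReal.ofReal ((N + 1) * (∑ j ∈ Finset.range N,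
      (specMass (reduced Φ) (Set.Iio (y j))).toReal ^ 2 / (y (j + 1) * D.size) +
        (specMass (reduced Φ) (Set.Iio (y N))).toReal)) := by
  obtain ⟨Λ⟩ := nonempty_spectralData Φ
  obtain ⟨s, hd, hle, hcard, htail⟩ := Λ.exists_blocks hΦ hy hpos hy0
  refine (Λ.fidelity_le_blocks hΦ D N s hd).trans (ENNReal.ofReal_le_ofReal ?_)
  gcongr with j hj
  · have h0 : 0 ≤ ∑ i ∈ s j, Λ.p i := Finset.sum_nonneg fun i _ => (Λ.pos i).le
    have hyj := hpos (j + 1)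
    calc _ ≤ (specMass (reduced Φ) (Set.Iio (y j))).toReal / y (j + 1) / D.size *
          (specMass (reduced Φ) (Set.Iio (y j))).toReal := by
          gcongr
          · exact hcard j
          · exact hle j
      _ = _ := by rw [div_div]; ring
  · exact htail N

theorem succProb_mul_le_grid {Φ : Sys (α × β)} (hΦ : ‖Φ‖ = 1) (I : PFLEC Φ)
    {y : ℕ → ℝ} (hy : Antitone y) (hpos : ∀ j, 0 < y j) (hy0 : 1 < y 0) (N : ℕ) :
    I.succProb * ENNReal.ofReal (1 - (∑ j ∈ Finset.range N,
      (specMass (reduced Φ) (Set.Iio (y j))).toReal / y (j + 1)) / I.size) ≤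
        specMass (reduced Φ) (Set.Iio (y N)) := by
  classical
  obtain ⟨Λ⟩ := nonempty_spectralData Φ
  obtain ⟨s, hd, hle, hcard, htail⟩ := Λ.exists_blocks hΦ hy hpos hy0
  have hsum := Finset.sum_biUnion (f := Λ.p) (s := Finset.range N) (t := s)
    fun i _ j _ hij => hd hij
  have h1 := Λ.succProb_mul_le hΦ I ((Finset.range N).biUnion s)
  have h2 : (((Finset.range N).biUnion s).card : ℝ) ≤ ∑ j ∈ Finset.range N,
      (specMass (reduced Φ) (Set.Iio (y j))).toReal / y (j + 1) := by
    calc _ ≤ ((∑ j ∈ Finset.range N, (s j).card : ℕ) : ℝ) := by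
          exact_mod_cast Finset.card_biUnion_le
      _ ≤ _ := by
          push_cast
          exact Finset.sum_le_sum fun j _ => hcard j
  calc _ ≤ _ := by gcongr
    _ ≤ _ := h1
    _ ≤ _ := by
      rw [hsum]
      refine (ENNReal.ofReal_le_ofReal (htail N)).trans_eq ?_
      exact ENNReal.ofReal_toReal (specMass_ne_top hΦ _)

theorem mul_le_sum_of_max_floor {Φ : Sys (α × β)} (Λ : SpectralData Φ) {x t : ℝ} (hx : 0 < x)
    (ht : 0 ≤ t) {s : Finset Λ.I} (hs : ∀ i ∈ s, Λ.p i ≤ x) (hts : t < ∑ i ∈ s, Λ.p i) {M : ℕ}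
    (hM : M ≤ max 1 ⌊t / x⌋₊) : ∀ i ∈ s, M * Λ.p i ≤ ∑ k ∈ s, Λ.p k := by
  intro i hi
  have hpi := (Λ.pos i).le
  rcases le_max_iff.mp hM with h | h
  · calc M * Λ.p i ≤ (1 : ℕ) * Λ.p i := by gcongr
      _ = Λ.p i := by simp
      _ ≤ _ := Finset.single_le_sum (fun k _ => (Λ.pos k).le) hi
  · calc M * Λ.p i ≤ t / x * x := by
          gcongr
          · exact (Nat.cast_le.mpr h).trans (Nat.floor_le (by positivity))
          · exact hs i hi
      _ = t := div_mul_cancel₀ _ hx.ne'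
      _ ≤ _ := hts.le

theorem half_le_max_floor (z : ℝ) : z / 2 ≤ ((max 1 ⌊z⌋₊ : ℕ) : ℝ) := by
  have h1 := Nat.lt_floor_add_one z
  have h2 : ((1 : ℕ) : ℝ) ≤ ((max 1 ⌊z⌋₊ : ℕ) : ℝ) := Nat.cast_le.mpr (le_max_left _ _)
  have h3 : ((⌊z⌋₊ : ℕ) : ℝ) ≤ ((max 1 ⌊z⌋₊ : ℕ) : ℝ) := Nat.cast_le.mpr (le_max_right _ _)
  push_cast at h2 h3 ⊢
  linarith

theorem exists_pflec_of_lt_specMass {Φ : Sys (α × β)} {x t : ℝ} (hx : 0 < x) (ht : 0 ≤ t)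
    {S : Set ℝ} (hS : S ⊆ Set.Iic x) (h : ENNReal.ofReal t < specMass (reduced Φ) S) :
    ∃ I : PFLEC Φ, t / (2 * x) ≤ I.size ∧ ENNReal.ofReal t ≤ I.succProb := by
  obtain ⟨Λ⟩ := nonempty_spectralData Φ
  obtain ⟨s, hs, hts⟩ := Λ.exists_lt_sum ht h
  have hne : s.Nonempty := Finset.nonempty_of_sum_ne_zero (ht.trans_lt hts).ne'
  obtain ⟨I, hI, hsucc⟩ := Λ.exists_pflec (M := max 1 ⌊t / x⌋₊) (by positivity) hne
    (mul_le_sum_of_max_floor Λ hx ht (fun i hi => hS (hs i hi)) hts le_rfl)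
  refine ⟨I, ?_, ?_⟩
  · rw [hI, mul_comm, ← div_div]
    exact half_le_max_floor _
  · rw [hsucc]
    exact ENNReal.ofReal_le_ofReal hts.le

theorem exists_dflec_of_lt_specMass {Φ : Sys (α × β)} {x t : ℝ} (hx : 0 < x) (ht : 0 ≤ t)
    {S : Set ℝ} (hS : S ⊆ Set.Iic x) (h : ENNReal.ofReal t < specMass (reduced Φ) S) {L : ℕ}
    (hL : 0 < L) : ∃ D : DFLEC α β, D.size = L ∧
      (ENNReal.ofReal t ≤ D.fidelity Φ ∨
        1 < L ∧ ENNReal.ofReal (t ^ 2 / (2 * x * L)) ≤ D.fidelity Φ) := by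
  obtain ⟨Λ⟩ := nonempty_spectralData Φ
  obtain ⟨s, hs, hts⟩ := Λ.exists_lt_sum ht h
  have hne : s.Nonempty := Finset.nonempty_of_sum_ne_zero (ht.trans_lt hts).ne'
  have hL' : (0 : ℝ) < L := by exact_mod_cast hL
  rcases le_total L (max 1 ⌊t / x⌋₊) with hLM | hLM
  · obtain ⟨D, hD, hF⟩ := Λ.exists_dflec hL le_rfl hne
      (mul_le_sum_of_max_floor Λ hx ht (fun i hi => hS (hs i hi)) hts hLM)
    refine ⟨D, hD, Or.inl (le_trans (ENNReal.ofReal_le_ofReal ?_) hF)⟩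
    rw [div_self hL'.ne', one_mul]
    exact hts.le
  · obtain ⟨D, hD, hF⟩ := Λ.exists_dflec (M := max 1 ⌊t / x⌋₊) (by positivity) hLM hne
      (mul_le_sum_of_max_floor Λ hx ht (fun i hi => hS (hs i hi)) hts le_rfl)
    refine ⟨D, hD, ?_⟩
    rcases hLM.eq_or_lt with h1 | h1
    · left
      refine le_trans (ENNReal.ofReal_le_ofReal ?_) hF
      rw [h1, div_self hL'.ne', one_mul]
      exact hts.le
    · right
      refine ⟨(le_max_left _ _).trans_lt h1, le_trans (ENNReal.ofReal_le_ofReal ?_) hF⟩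
      have h2 := half_le_max_floor (t / x)
      calc t ^ 2 / (2 * x * L) = t / x / 2 / L * t := by field_simp
        _ ≤ _ := by gcongr

end OneShot

section Exponents

theorem eventually_const_mul_exp_le (C : ℝ) {a b : ℝ} (h : b < a) :
    ∀ᶠ n : ℕ in atTop, C * Real.exp (-n * a) ≤ Real.exp (-n * b) := by
  have h1 : Tendsto (fun n : ℕ => Real.exp (n * (a - b))) atTop atTop :=
    Real.tendsto_exp_atTop.comp
      (tendsto_natCast_atTop_atTop.atTop_mul_const (sub_pos.mpr h))
  filter_upwards [h1.eventually_ge_atTop C] with n hn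
  calc C * Real.exp (-n * a) ≤ Real.exp (n * (a - b)) * Real.exp (-n * a) := by gcongr
    _ = Real.exp (-n * b) := by rw [← Real.exp_add]; congr 1; ring

theorem eventually_exp_le (C : ℝ) (hC : 0 < C) {a : ℝ} (h : 0 < a) :
    ∀ᶠ n : ℕ in atTop, Real.exp (-n * a) ≤ C := by
  filter_upwards [eventually_const_mul_exp_le C⁻¹ h] with n hn
  rw [mul_zero, Real.exp_zero] at hn
  rwa [inv_mul_le_iff₀ hC, mul_one] at hn

theorem le_expo_iff {n : ℕ} (hn : 0 < n) {p : ℝ≥0∞} {c : ℝ} :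
    (c : EReal) ≤ expo n p ↔ p ≤ ENNReal.ofReal (Real.exp (-n * c)) := by
  have hn' : (0 : EReal) < n := by exact_mod_cast hn
  rw [expo, EReal.le_div_iff_mul_le hn' (EReal.natCast_ne_top n), EReal.le_neg, ← ENNReal.log_le_log_iff,
    ENNReal.log_ofReal_of_pos (Real.exp_pos _), Real.log_exp]
  have : -((c : EReal) * (n : EReal)) = ((-n * c : ℝ) : EReal) := by
    rw [← EReal.coe_coe_eq_natCast, ← EReal.coe_mul, ← EReal.coe_neg]
    congr 1
    ring
  rw [this]

theorem expo_le_iff {n : ℕ} (hn : 0 < n) {p : ℝ≥0∞} {c : ℝ} :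
    expo n p ≤ (c : EReal) ↔ ENNReal.ofReal (Real.exp (-n * c)) ≤ p := by
  have hn' : (0 : EReal) < n := by exact_mod_cast hn
  rw [expo, EReal.div_le_iff_le_mul hn' (EReal.natCast_ne_top n), EReal.neg_le, ← ENNReal.log_le_log_iff,
    ENNReal.log_ofReal_of_pos (Real.exp_pos _), Real.log_exp]
  have : -((n : EReal) * (c : EReal)) = ((-n * c : ℝ) : EReal) := by
    rw [← EReal.coe_coe_eq_natCast, ← EReal.coe_mul, ← EReal.coe_neg]
    congr 1
    ring
  rw [this]

theorem expo_nonneg (n : ℕ) {p : ℝ≥0∞} (hp : p ≤ 1) : 0 ≤ expo n p := by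
  rcases Nat.eq_zero_or_pos n with rfl | hn
  · simp [expo]
  · have := (le_expo_iff hn (p := p) (c := 0)).mpr (by simpa using hp)
    simpa using this

theorem expo_anti (n : ℕ) {p q : ℝ≥0∞} (h : p ≤ q) : expo n q ≤ expo n p := by
  rw [expo, expo]
  exact EReal.div_le_div_right_of_nonneg (by positivity)
    (EReal.neg_le_neg_iff.mpr (ENNReal.log_le_log h))

theorem le_liminf_expo_iff {u : ℕ → ℝ≥0∞} {r : ℝ} :
    (r : EReal) ≤ liminf (fun n => expo n (u n)) atTop ↔
      ∀ r' < r, ∀ᶠ n : ℕ in atTop, u n ≤ ENNReal.ofReal (Real.exp (-n * r')) := by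
  rw [le_liminf_iff]
  constructor
  · intro h r' hr'
    filter_upwards [h r' (by exact_mod_cast hr'), eventually_gt_atTop 0] with n hn hn0
    exact (le_expo_iff hn0).mp hn.le
  · intro h y hy
    obtain ⟨r', h1, h2⟩ := EReal.lt_iff_exists_real_btwn.mp hy
    filter_upwards [h r' (by exact_mod_cast h2), eventually_gt_atTop 0] with n hn hn0
    exact h1.trans_le ((le_expo_iff hn0).mpr hn)

theorem limsup_expo_le_iff {u : ℕ → ℝ≥0∞} {r : ℝ} :
    limsup (fun n => expo n (u n)) atTop ≤ (r : EReal) ↔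
      ∀ r' > r, ∀ᶠ n : ℕ in atTop, ENNReal.ofReal (Real.exp (-n * r')) ≤ u n := by
  rw [limsup_le_iff]
  constructor
  · intro h r' hr'
    filter_upwards [h r' (by exact_mod_cast hr'), eventually_gt_atTop 0] with n hn hn0
    exact (expo_le_iff hn0).mp hn.le
  · intro h y hy
    obtain ⟨r', h1, h2⟩ := EReal.lt_iff_exists_real_btwn.mp hy
    filter_upwards [h r' (by exact_mod_cast h1), eventually_gt_atTop 0] with n hn hn0
    exact ((expo_le_iff hn0).mpr hn).trans_lt h2

theorem le_rate {L : ℕ → ℕ} (hL : ∀ n, 0 < L n) {R : ℝ}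
    (h : ∀ R' < R, ∀ᶠ n : ℕ in atTop, Real.exp (-n * -R') ≤ L n) : (R : EReal) ≤ rate L := by
  rw [rate, le_liminf_iff]
  intro y hy
  obtain ⟨R', h1, h2⟩ := EReal.lt_iff_exists_real_btwn.mp hy
  filter_upwards [h R' (by exact_mod_cast h2), eventually_gt_atTop 0] with n hn hn0
  refine h1.trans_le (EReal.coe_le_coe_iff.mpr ?_)
  have hn' : (0 : ℝ) < n := by exact_mod_cast hn0
  rw [le_div_iff₀ hn', Real.le_log_iff_exp_le (by exact_mod_cast hL n)]
  convert hn using 2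
  ring

theorem eventually_le_of_lt_rate {L : ℕ → ℕ} (hL : ∀ n, 0 < L n) {R : ℝ}
    (h : (R : EReal) < rate L) : ∀ᶠ n : ℕ in atTop, Real.exp (-n * -R) ≤ L n := by
  filter_upwards [eventually_lt_of_lt_liminf h, eventually_gt_atTop 0] with n hn hn0
  have hn' : (0 : ℝ) < n := by exact_mod_cast hn0
  have h1 := (EReal.coe_lt_coe_iff.mp hn).le
  rw [le_div_iff₀ hn', Real.le_log_iff_exp_le (by exact_mod_cast hL n)] at h1
  convert h1 using 2
  ring

theorem le_rate_of_const_mul {L : ℕ → ℕ} (hL : ∀ n, 0 < L n) {R C : ℝ} (hC : 0 < C)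
    (h : ∀ R' < R, ∀ᶠ n : ℕ in atTop, C * Real.exp (-n * -R') ≤ L n) : (R : EReal) ≤ rate L := by
  refine le_rate hL fun R' hR' => ?_
  obtain ⟨R'', h1, h2⟩ := exists_between hR'
  filter_upwards [h R'' h2, eventually_const_mul_exp_le C⁻¹ (neg_lt_neg h1)] with n hn hn'
  rw [inv_mul_le_iff₀ hC] at hn'
  exact hn'.trans hn

theorem limsup_le_ofReal_iff {u : ℕ → ℝ≥0∞} {ε : ℝ} (hε : 0 ≤ ε) :
    limsup u atTop ≤ ENNReal.ofReal ε ↔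
      ∀ z > ε, ∀ᶠ n in atTop, u n ≤ ENNReal.ofReal z := by
  rw [limsup_le_iff]
  constructor
  · intro h z hz
    filter_upwards [h _ ((ENNReal.ofReal_lt_ofReal_iff (hε.trans_lt hz)).mpr hz)] with n hn
    exact hn.le
  · intro h y hy
    obtain ⟨z, hz0, h1, h2⟩ := ENNReal.lt_iff_exists_real_btwn.mp hy
    filter_upwards [h z ((ENNReal.ofReal_lt_ofReal_iff_of_nonneg hε).mp h1)] with n hn
    exact hn.trans_lt h2

theorem ofReal_one_sub_le_liminf_iff {u : ℕ → ℝ≥0∞} {ε : ℝ} :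
    ENNReal.ofReal (1 - ε) ≤ liminf u atTop ↔
      ∀ z > ε, ∀ᶠ n in atTop, ENNReal.ofReal (1 - z) ≤ u n := by
  rw [le_liminf_iff]
  constructor
  · intro h z hz
    rcases le_or_gt (1 - ε) 0 with h0 | h0
    · refine Eventually.of_forall fun n => ?_
      rw [ENNReal.ofReal_of_nonpos (by linarith)]
      exact zero_le
    · filter_upwards [h (ENNReal.ofReal (1 - z))
        ((ENNReal.ofReal_lt_ofReal_iff h0).mpr (by linarith))] with n hn
      exact hn.le
  · intro h y hy
    obtain ⟨z, hz0, h1, h2⟩ := ENNReal.lt_iff_exists_real_btwn.mp hy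
    have h3 := (ENNReal.ofReal_lt_ofReal_iff_of_nonneg hz0).mp h2
    filter_upwards [h (1 - z) (by linarith)] with n hn
    rw [sub_sub_cancel] at hn
    exact h1.trans_le hn

end Exponents

section WeakRates

variable {ι κ : ℕ → Type} {Φ : ∀ n, Sys (ι n × κ n)}

theorem PFLEC.failProb_le_one {α β : Type} {Φ : Sys (α × β)} (I : PFLEC Φ) (hΦ : ‖Φ‖ = 1) :
    I.failProb ≤ 1 := le_add_self.trans_eq (I.succProb_add_failProb hΦ)

theorem PFLEC.succProb_le_one {α β : Type} {Φ : Sys (α × β)} (I : PFLEC Φ) (hΦ : ‖Φ‖ = 1) :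
    I.succProb ≤ 1 := le_self_add.trans_eq (I.succProb_add_failProb hΦ)

theorem PFLEC.failProb_eq {α β : Type} {Φ : Sys (α × β)} (I : PFLEC Φ) (hΦ : ‖Φ‖ = 1) :
    I.failProb = 1 - I.succProb :=
  ENNReal.eq_sub_of_add_eq (ne_top_of_le_ne_top ENNReal.one_ne_top (I.succProb_le_one hΦ))
    (by rw [add_comm, I.succProb_add_failProb hΦ])

theorem PFLEC.failProb_le {α β : Type} {Φ : Sys (α × β)} (I : PFLEC Φ) (hΦ : ‖Φ‖ = 1) {t : ℝ}
    (ht : 0 ≤ t) (h : ENNReal.ofReal t ≤ I.succProb) : I.failProb ≤ ENNReal.ofReal (1 - t) := by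
  rw [I.failProb_eq hΦ, ENNReal.ofReal_sub _ ht, ENNReal.ofReal_one]
  exact tsub_le_tsub_left h 1

theorem exists_pflec_seq (hΦ : ∀ n, ‖Φ n‖ = 1) {x : ℕ → ℝ} (hx : ∀ n, 0 < x n)
    {S : ℕ → Set ℝ} (hS : ∀ n, S n ⊆ Set.Iic (x n)) (t : ℕ → ℝ) :
    ∃ I : ∀ n, PFLEC (Φ n), ∀ n, 0 ≤ t n →
      ENNReal.ofReal (t n) < specMass (reduced (Φ n)) (S n) →
      t n / (2 * x n) ≤ (I n).size ∧ ENNReal.ofReal (t n) ≤ (I n).succProb := by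
  have h : ∀ n, ∃ I : PFLEC (Φ n), 0 ≤ t n →
      ENNReal.ofReal (t n) < specMass (reduced (Φ n)) (S n) →
      t n / (2 * x n) ≤ I.size ∧ ENNReal.ofReal (t n) ≤ I.succProb := by
    intro n
    by_cases h : 0 ≤ t n ∧ ENNReal.ofReal (t n) < specMass (reduced (Φ n)) (S n)
    · obtain ⟨I, hI⟩ := exists_pflec_of_lt_specMass (hx n) h.1 (hS n) h.2
      exact ⟨I, fun _ _ => hI⟩
    · obtain ⟨I, -⟩ := exists_pflec_size (hΦ n) one_pos
      exact ⟨I, fun h1 h2 => absurd ⟨h1, h2⟩ h⟩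
  choose I hI using h
  exact ⟨I, hI⟩

theorem exists_pflec_rate (hΦ : ∀ n, ‖Φ n‖ = 1) (R : ℝ) :
    ∃ I : ∀ n, PFLEC (Φ n), (R : EReal) ≤ rate fun n => (I n).size := by
  choose I hI using fun n : ℕ => exists_pflec_size (hΦ n)
    (Nat.ceil_pos.mpr (Real.exp_pos (-n * -R)))
  refine ⟨I, le_rate (fun n => (I n).target_spec.1) fun R' hR' => Eventually.of_forall fun n => ?_⟩
  rw [hI]
  refine le_trans (Real.exp_le_exp.mpr ?_) (Nat.le_ceil _)
  rw [neg_mul_neg, neg_mul_neg]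
  gcongr

theorem le_rate_of_pflec_size {I : ∀ n, PFLEC (Φ n)} {R C : ℝ} {t : ℕ → ℝ} (hC : 0 < C)
    (h : ∀ᶠ n : ℕ in atTop, C ≤ t n ∧ t n / (2 * Real.exp (-n * R)) ≤ (I n).size) :
    (R : EReal) ≤ rate fun n => (I n).size := by
  refine le_rate_of_const_mul (fun n => (I n).target_spec.1) (half_pos hC) fun R' hR' => ?_
  filter_upwards [h] with n hn
  refine le_trans ?_ hn.2
  calc C / 2 * Real.exp (-n * -R') ≤ t n / 2 * Real.exp (-n * -R) := by
        have h1 := hn.1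
        have h2 : 0 ≤ t n := hC.le.trans h1
        rw [neg_mul_neg, neg_mul_neg]
        gcongr
    _ = _ := by
        rw [mul_neg, Real.exp_neg]
        field_simp

theorem le_BP (hΦ : ∀ n, ‖Φ n‖ = 1) {ε : ℝ} (h0 : 0 ≤ ε) (h1 : ε ≤ 1) {R : ℝ}
    (hR : K Φ R ≤ ENNReal.ofReal ε) : (R : EReal) ≤ BP Φ ε := by
  rcases h1.eq_or_lt with rfl | h1
  · obtain ⟨I, hI⟩ := exists_pflec_rate hΦ R
    refine le_iSup₂_of_le I ((limsup_le_ofReal_iff h0).mpr fun z hz =>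
      Eventually.of_forall fun n => ((I n).failProb_le_one (hΦ n)).trans ?_) hI
    rw [← ENNReal.ofReal_one]
    exact ENNReal.ofReal_le_ofReal hz.le
  set m : ℕ → ℝ := fun n => (specMass (reduced (Φ n)) (Set.Ici (Real.exp (-n * R)))).toReal
  have hm : ∀ z > ε, ∀ᶠ n in atTop, m n ≤ z := fun z hz => by
    filter_upwards [(limsup_le_ofReal_iff h0).mp hR z hz] with n hn
    exact ENNReal.toReal_le_of_le_ofReal (h0.trans hz.le) hn
  have hδ : ∀ d > (0 : ℝ), ∀ᶠ n : ℕ in atTop, 1 / ((n : ℝ) + 1) ≤ d := fun d hd => by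
    filter_upwards [(tendsto_one_div_add_atTop_nhds_zero_nat (𝕜 := ℝ)).eventually_lt_const hd]
      with n hn using hn.le
  obtain ⟨I, hI⟩ := exists_pflec_seq hΦ (x := fun n => Real.exp (-n * R))
    (fun n => Real.exp_pos _) (S := fun n => Set.Iio (Real.exp (-n * R)))
    (fun n => Set.Iio_subset_Iic_self) fun n => 1 - m n - 1 / ((n : ℝ) + 1)
  have hev : ∀ᶠ n : ℕ in atTop, (1 - ε) / 4 ≤ 1 - m n - 1 / ((n : ℝ) + 1) ∧
      (1 - m n - 1 / ((n : ℝ) + 1)) / (2 * Real.exp (-n * R)) ≤ (I n).size ∧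
      (I n).failProb ≤ ENNReal.ofReal (m n + 1 / ((n : ℝ) + 1)) := by
    filter_upwards [hm (ε + (1 - ε) / 2) (by linarith), hδ ((1 - ε) / 4) (by linarith)]
      with n hn1 hn2
    have ht : (1 - ε) / 4 ≤ 1 - m n - 1 / ((n : ℝ) + 1) := by linarith
    have ht0 : 0 ≤ 1 - m n - 1 / ((n : ℝ) + 1) := by linarith
    have hlt : ENNReal.ofReal (1 - m n - 1 / ((n : ℝ) + 1)) <
        specMass (reduced (Φ n)) (Set.Iio (Real.exp (-n * R))) := by
      rw [ENNReal.ofReal_lt_iff_lt_toReal ht0 (specMass_ne_top (hΦ n) _)]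
      have h3 := toReal_specMass_add_compl (hΦ n) (Set.Ici (Real.exp (-n * R)))
      rw [Set.compl_Ici] at h3
      have h4 : (0 : ℝ) < 1 / ((n : ℝ) + 1) := by positivity
      simp only [m]
      linarith
    obtain ⟨h5, h6⟩ := hI n ht0 hlt
    refine ⟨ht, h5, ?_⟩
    convert (I n).failProb_le (hΦ n) ht0 h6 using 2
    ring
  refine le_iSup₂_of_le I ((limsup_le_ofReal_iff h0).mpr fun z hz => ?_)
    (le_rate_of_pflec_size (by linarith) (hev.mono fun n hn => ⟨hn.1, hn.2.1⟩))
  filter_upwards [hev, hm (ε + (z - ε) / 2) (by linarith), hδ ((z - ε) / 2) (by linarith)]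
    with n hn h2 h3
  exact hn.2.2.trans (ENNReal.ofReal_le_ofReal (by linarith))

theorem BP_le_BD (hΦ : ∀ n, ‖Φ n‖ = 1) {ε : ℝ} (h0 : 0 ≤ ε) : BP Φ ε ≤ BD Φ ε := by
  refine iSup₂_le fun I hI => le_iSup₂_of_le (fun n => (I n).toDFLEC)
    (ofReal_one_sub_le_liminf_iff.mpr fun z hz => ?_) le_rfl
  filter_upwards [(limsup_le_ofReal_iff h0).mp hI z hz] with n hn
  refine le_trans ?_ (I n).succProb_le_fidelity
  rw [ENNReal.ofReal_sub _ (h0.trans hz.le), ENNReal.ofReal_one, tsub_le_iff_right]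
  rw [← (I n).succProb_add_failProb (hΦ n)]
  gcongr

theorem BD_le (hΦ : ∀ n, ‖Φ n‖ = 1) {ε : ℝ} (h0 : 0 ≤ ε) :
    BD Φ ε ≤ ⨆ (R : ℝ) (_ : K Φ R ≤ ENNReal.ofReal ε), (R : EReal) := by
  refine iSup₂_le fun D hD => EReal.ge_of_forall_gt_iff_ge.mp fun R hR => ?_
  obtain ⟨R', hRR', hR'⟩ := EReal.lt_iff_exists_real_btwn.mp hR
  have hRR : R < R' := by exact_mod_cast hRR'
  refine le_iSup₂_of_le R ((limsup_le_ofReal_iff h0).mpr fun z hz => ?_) le_rfl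
  obtain ⟨w, hw1, hw2⟩ := exists_between hz
  have hd : 0 < min 1 ((z - w) / 3) := lt_min one_pos (by linarith)
  filter_upwards [eventually_le_of_lt_rate (fun n => (D n).target_spec.1) hR',
    ofReal_one_sub_le_liminf_iff.mp hD w hw1,
    eventually_exp_le _ hd (half_pos (sub_pos.mpr hRR))] with n h1 h2 h3
  have hx : (0 : ℝ) < Real.exp (-n * R) := Real.exp_pos _
  have h4 := specMass_mul_add_fidelity_le (hΦ n) (D n) hx
    (Real.exp_pos (-n * ((R' - R) / 2))) (by
      calc (1 : ℝ) = Real.exp (-n * ((R' - R) / 2)) ^ 2 *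
            (Real.exp (-n * R) * Real.exp (-n * -R')) := by
            rw [sq, ← Real.exp_add, ← Real.exp_add, ← Real.exp_add, ← Real.exp_zero]
            congr 1
            ring
        _ ≤ _ := by gcongr) (S := Set.Ici (Real.exp (-n * R))) subset_rfl
  set θ := Real.exp (-n * ((R' - R) / 2)) with hθ
  have hθ0 : 0 < θ := Real.exp_pos _
  have hF : 1 - w ≤ ((D n).fidelity (Φ n)).toReal :=
    (ENNReal.ofReal_le_iff_le_toReal (ne_top_of_le_ne_top ENNReal.one_ne_top
      ((D n).fidelity_le_one (hΦ n)))).mp h2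
  have hm1 := toReal_specMass_le_one (hΦ n) (Set.Ici (Real.exp (-n * R)))
  have hm0 : 0 ≤ (specMass (reduced (Φ n)) (Set.Ici (Real.exp (-n * R)))).toReal :=
    ENNReal.toReal_nonneg
  rw [← ENNReal.ofReal_toReal (specMass_ne_top (hΦ n) _)]
  refine ENNReal.ofReal_le_ofReal ?_
  have h5 := h3.trans (min_le_left _ _)
  have h6 := h3.trans (min_le_right _ _)
  have h7 : θ ^ 2 ≤ θ := by nlinarith
  nlinarith

theorem le_BeP (hΦ : ∀ n, ‖Φ n‖ = 1) {r R : ℝ} (hR : (r : EReal) ≤ zetaC Φ R) :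
    (R : EReal) ≤ BeP Φ r := by
  rcases le_or_gt r 0 with hr | hr
  · obtain ⟨I, hI⟩ := exists_pflec_rate hΦ R
    refine le_iSup₂_of_le I (le_liminf_expo_iff.mpr fun r' hr' =>
      Eventually.of_forall fun n => ((I n).failProb_le_one (hΦ n)).trans ?_) hI
    rw [← ENNReal.ofReal_one]
    refine ENNReal.ofReal_le_ofReal (Real.one_le_exp ?_)
    have : r' ≤ 0 := hr'.le.trans hr
    nlinarith [(Nat.cast_nonneg n : (0 : ℝ) ≤ n)]
  set m : ℕ → ℝ := fun n => (specMass (reduced (Φ n)) (Set.Ioi (Real.exp (-n * R)))).toReal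
  have hm : ∀ r' < r, ∀ᶠ n : ℕ in atTop, m n ≤ Real.exp (-n * r') := fun r' hr' => by
    filter_upwards [le_liminf_expo_iff.mp hR r' hr'] with n hn
    exact ENNReal.toReal_le_of_le_ofReal (Real.exp_pos _).le hn
  obtain ⟨I, hI⟩ := exists_pflec_seq hΦ (x := fun n => Real.exp (-n * R))
    (fun n => Real.exp_pos _) (S := fun n => Set.Iic (Real.exp (-n * R)))
    (fun n => subset_rfl) fun n => 1 - m n - Real.exp (-n * r)
  have hev : ∀ᶠ n : ℕ in atTop, 1 / 2 ≤ 1 - m n - Real.exp (-n * r) ∧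
      (1 - m n - Real.exp (-n * r)) / (2 * Real.exp (-n * R)) ≤ (I n).size ∧
      (I n).failProb ≤ ENNReal.ofReal (m n + Real.exp (-n * r)) := by
    filter_upwards [hm (r / 2) (by linarith),
      eventually_exp_le (1 / 4) (by norm_num) (half_pos hr),
      eventually_exp_le (1 / 4) (by norm_num) hr] with n hn1 hn2 hn3
    have ht : 1 / 2 ≤ 1 - m n - Real.exp (-n * r) := by linarith
    have ht0 : 0 ≤ 1 - m n - Real.exp (-n * r) := by linarith
    have hlt : ENNReal.ofReal (1 - m n - Real.exp (-n * r)) <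
        specMass (reduced (Φ n)) (Set.Iic (Real.exp (-n * R))) := by
      rw [ENNReal.ofReal_lt_iff_lt_toReal ht0 (specMass_ne_top (hΦ n) _)]
      have h3 := toReal_specMass_add_compl (hΦ n) (Set.Ioi (Real.exp (-n * R)))
      rw [Set.compl_Ioi] at h3
      have h4 := Real.exp_pos (-n * r)
      simp only [m]
      linarith
    obtain ⟨h5, h6⟩ := hI n ht0 hlt
    refine ⟨ht, h5, ?_⟩
    convert (I n).failProb_le (hΦ n) ht0 h6 using 2
    ring
  refine le_iSup₂_of_le I (le_liminf_expo_iff.mpr fun r' hr' => ?_)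
    (le_rate_of_pflec_size (by norm_num) (hev.mono fun n hn => ⟨hn.1, hn.2.1⟩))
  obtain ⟨r'', h1, h2⟩ := exists_between hr'
  filter_upwards [hev, hm r'' h2, eventually_const_mul_exp_le 1 h2,
    eventually_const_mul_exp_le 2 h1] with n hn h3 h4 h5
  exact hn.2.2.trans (ENNReal.ofReal_le_ofReal (by linarith))

theorem BeP_le_BeD (hΦ : ∀ n, ‖Φ n‖ = 1) (r : ℝ) : BeP Φ r ≤ BeD Φ r := by
  refine iSup₂_le fun I hI => le_iSup₂_of_le (fun n => (I n).toDFLEC)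
    (hI.trans (liminf_le_liminf (Eventually.of_forall fun n => expo_anti n ?_))) le_rfl
  rw [(I n).failProb_eq (hΦ n)]
  exact tsub_le_tsub_left (I n).succProb_le_fidelity 1

theorem BeD_le (hΦ : ∀ n, ‖Φ n‖ = 1) (r : ℝ) :
    BeD Φ r ≤ ⨆ (R : ℝ) (_ : (r : EReal) ≤ zetaC Φ R), (R : EReal) := by
  refine iSup₂_le fun D hD => EReal.ge_of_forall_gt_iff_ge.mp fun R hR => ?_
  obtain ⟨R', hRR', hR'⟩ := EReal.lt_iff_exists_real_btwn.mp hR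
  have hRR : R < R' := by exact_mod_cast hRR'
  refine le_iSup₂_of_le R (le_liminf_expo_iff.mpr fun r' hr' => ?_) le_rfl
  obtain ⟨r'', hr1, hr2⟩ := exists_between hr'
  filter_upwards [eventually_le_of_lt_rate (fun n => (D n).target_spec.1) hR',
    le_liminf_expo_iff.mp hD r'' hr2, eventually_const_mul_exp_le 2 hr1,
    eventually_exp_le (1 / 8) (by norm_num) (half_pos (sub_pos.mpr hRR))] with n h1 h2 h2' h3
  have hx : (0 : ℝ) < Real.exp (-n * R) := Real.exp_pos _
  have h4 := specMass_mul_add_fidelity_le (hΦ n) (D n) hx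
    (Real.exp_pos (-n * ((R' - R) / 2))) (by
      calc (1 : ℝ) = Real.exp (-n * ((R' - R) / 2)) ^ 2 *
            (Real.exp (-n * R) * Real.exp (-n * -R')) := by
            rw [sq, ← Real.exp_add, ← Real.exp_add, ← Real.exp_add, ← Real.exp_zero]
            congr 1
            ring
        _ ≤ _ := by gcongr) (S := Set.Ioi (Real.exp (-n * R))) Set.Ioi_subset_Ici_self
  set θ := Real.exp (-n * ((R' - R) / 2)) with hθ
  have hθ0 : 0 < θ := Real.exp_pos _
  have hF1 := (D n).fidelity_le_one (hΦ n)
  have hF : 1 - ((D n).fidelity (Φ n)).toReal ≤ Real.exp (-n * r'') := by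
    have h5 := ENNReal.toReal_le_of_le_ofReal (Real.exp_pos _).le h2
    rwa [ENNReal.toReal_sub_of_le hF1 ENNReal.one_ne_top, ENNReal.toReal_one] at h5
  have hm0 : 0 ≤ (specMass (reduced (Φ n)) (Set.Ioi (Real.exp (-n * R)))).toReal :=
    ENNReal.toReal_nonneg
  rw [← ENNReal.ofReal_toReal (specMass_ne_top (hΦ n) _)]
  refine ENNReal.ofReal_le_ofReal ?_
  have h7 : 1 / 2 ≤ 1 - 2 * θ - θ ^ 2 := by nlinarith
  have h8 := mul_le_mul_of_nonneg_left h7 hm0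
  linarith

end WeakRates

section StrongConverse

variable {ι κ : ℕ → Type} {Φ : ∀ n, Sys (ι n × κ n)} {ζ : ℝ → EReal}

theorem IsZeta.nonneg (hζ : IsZeta Φ ζ) (hΦ : ∀ n, ‖Φ n‖ = 1) (a : ℝ) : 0 ≤ ζ a :=
  ge_of_tendsto' (hζ a) fun n => expo_nonneg n (specMass_le_one (hΦ n) _)

theorem IsZeta.mono (hζ : IsZeta Φ ζ) : Monotone ζ := fun a b hab => by
  refine le_of_tendsto_of_tendsto' (hζ a) (hζ b) fun n =>
    expo_anti n (specMass_mono _ (Set.Iio_subset_Iio (Real.exp_le_exp.mpr ?_)))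
  rw [neg_mul, neg_mul, neg_le_neg_iff]
  gcongr

theorem IsZeta.eventually_le (hζ : IsZeta Φ ζ) {a c : ℝ} (h : (c : EReal) < ζ a) :
    ∀ᶠ n : ℕ in atTop, specMass (reduced (Φ n)) (Set.Iio (Real.exp (-n * a))) ≤
      ENNReal.ofReal (Real.exp (-n * c)) := by
  filter_upwards [(hζ a).eventually_const_lt h, eventually_gt_atTop 0] with n hn hn0
  exact (le_expo_iff hn0).mp hn.le

theorem IsZeta.eventually_ge (hζ : IsZeta Φ ζ) {a c : ℝ} (h : ζ a < c) :
    ∀ᶠ n : ℕ in atTop, ENNReal.ofReal (Real.exp (-n * c)) ≤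
      specMass (reduced (Φ n)) (Set.Iio (Real.exp (-n * a))) := by
  filter_upwards [(hζ a).eventually_lt_const h, eventually_gt_atTop 0] with n hn hn0
  exact (expo_le_iff hn0).mp hn.le

theorem IsZeta.exists_real (hζ : IsZeta Φ ζ) (hΦ : ∀ n, ‖Φ n‖ = 1) {a r : ℝ} (h : ζ a ≤ r) :
    ∃ z : ℝ, ζ a = z := by
  refine ⟨(ζ a).toReal, (EReal.coe_toReal ?_ ?_).symm⟩
  · exact (h.trans_lt (EReal.coe_lt_top r)).ne
  · exact ((EReal.bot_lt_zero).trans_le (hζ.nonneg hΦ a)).ne'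

theorem not_eventually_le_const_mul_exp {u : ℕ → ℝ≥0∞} {r c C : ℝ} (hrc : r < c)
    (hu : limsup (fun n => expo n (u n)) atTop ≤ (r : EReal)) :
    ¬ ∀ᶠ n : ℕ in atTop, u n ≤ ENNReal.ofReal (C * Real.exp (-n * c)) := by
  intro h
  obtain ⟨r₂, h1, h2⟩ := exists_between hrc
  obtain ⟨r₁, h3, h4⟩ := exists_between h1
  obtain ⟨n, hn1, hn2, hn3, hn0⟩ := (h.and ((limsup_expo_le_iff.mp hu r₁ h3).and
    ((eventually_const_mul_exp_le C h2).and (eventually_gt_atTop 0)))).exists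
  have h5 := (ENNReal.ofReal_le_ofReal_iff (Real.exp_pos _).le).mp
    (hn2.trans (hn1.trans (ENNReal.ofReal_le_ofReal hn3)))
  have hn' : (0 : ℝ) < n := by exact_mod_cast hn0
  rw [Real.exp_le_exp] at h5
  nlinarith

/-- The thresholds `exp (-n (c + j h))` are decreasing in `j`. -/
theorem antitone_grid (n : ℕ) (c : ℝ) {h : ℝ} (hh : 0 ≤ h) :
    Antitone fun j : ℕ => Real.exp (-n * (c + j * h)) := fun i j hij => by
  refine Real.exp_le_exp.mpr ?_
  rw [neg_mul, neg_mul, neg_le_neg_iff]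
  gcongr

theorem infHalf_add_le_of_limsup_le (hζ : IsZeta Φ ζ) (hΦ : ∀ n, ‖Φ n‖ = 1)
    {D : ∀ n, DFLEC (ι n) (κ n)} {r R : ℝ}
    (hD : limsup (fun n => expo n ((D n).fidelity (Φ n))) atTop ≤ (r : EReal))
    (hR : (R : EReal) < rate fun n => (D n).size) :
    infHalf ζ (R + r) + (((R + r) / 2 : ℝ) : EReal) ≤ r := by
  by_contra! hlt
  obtain ⟨c, hc1, hc2⟩ := EReal.lt_iff_exists_real_btwn.mp hlt
  have hrc : r < c := by exact_mod_cast hc1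
  set a := R + r with ha
  set δ := c - r with hδ
  have hδ0 : 0 < δ := sub_pos.mpr hrc
  have hz : ∀ a' ≤ a, ((c - (a - a') / 2 : ℝ) : EReal) < ζ a' := by
    intro a' ha'
    have h1 : infHalf ζ a ≤ ζ a' - ((a' / 2 : ℝ) : EReal) := iInf₂_le a' ha'
    have h2 := hc2.trans_le (add_le_add_left h1 _)
    generalize ζ a' = x at h2 ⊢
    induction x using EReal.rec with
    | bot => simp at h2
    | top => exact EReal.coe_lt_top _
    | coe x =>
      rw [← EReal.coe_sub, ← EReal.coe_add, EReal.coe_lt_coe_iff] at h2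
      rw [EReal.coe_lt_coe_iff]
      linarith
  obtain ⟨N, hN⟩ := exists_nat_gt (a / δ)
  rw [div_lt_iff₀ hδ0] at hN
  let g : ℕ → ℝ := fun j => a - N * δ + j * δ
  have hgN : g N = a := by simp only [g]; ring
  have hga : ∀ j ∈ Finset.range (N + 1), g j ≤ a := fun j hj => by
    have : (j : ℝ) ≤ N := by exact_mod_cast Nat.lt_succ_iff.mp (Finset.mem_range.mp hj)
    rw [← hgN]
    simp only [g]
    gcongr
  have hT := (eventually_all_finset (Finset.range (N + 1))).mpr fun j hj =>
    hζ.eventually_le (hz (g j) (hga j hj))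
  refine not_eventually_le_const_mul_exp (C := (N + 1) * (N + 1)) hrc hD ?_
  filter_upwards [hT, eventually_le_of_lt_rate (fun n => (D n).target_spec.1) hR,
    eventually_gt_atTop 0] with n hn1 hn2 hn0
  have hn' : (0 : ℝ) < n := by exact_mod_cast hn0
  have hT' : ∀ j ∈ Finset.range (N + 1),
      (specMass (reduced (Φ n)) (Set.Iio (Real.exp (-n * g j)))).toReal ≤
        Real.exp (-n * (c - (a - g j) / 2)) := fun j hj =>
    ENNReal.toReal_le_of_le_ofReal (Real.exp_pos _).le (hn1 j hj)
  refine (fidelity_le_grid (hΦ n) (D n) (antitone_grid n (a - N * δ) hδ0.le)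
    (fun j => Real.exp_pos _) (Real.one_lt_exp_iff.mpr ?_) N).trans (ENNReal.ofReal_le_ofReal ?_)
  · push_cast
    nlinarith
  have hterm : ∀ j ∈ Finset.range N,
      (specMass (reduced (Φ n)) (Set.Iio (Real.exp (-n * g j)))).toReal ^ 2 /
        (Real.exp (-n * g (j + 1)) * (D n).size) ≤ Real.exp (-n * c) := by
    intro j hj
    have hj' : j ∈ Finset.range (N + 1) := Finset.range_mono N.le_succ hj
    calc _ ≤ Real.exp (-n * (c - (a - g j) / 2)) ^ 2 /
          (Real.exp (-n * g (j + 1)) * Real.exp (-n * -R)) := by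
          gcongr
          exact hT' j hj'
      _ = Real.exp (-n * c) := by
          rw [sq, ← Real.exp_add, ← Real.exp_add, ← Real.exp_sub]
          congr 1
          simp only [g, hδ, ha]
          push_cast
          ring
  have hlast := hT' N (Finset.self_mem_range_succ N)
  rw [hgN, sub_self, zero_div, sub_zero, ← hgN] at hlast
  have hsum := Finset.sum_le_card_nsmul _ _ _ hterm
  rw [Finset.card_range, nsmul_eq_mul] at hsum
  calc _ ≤ ((N : ℝ) + 1) * (N * Real.exp (-n * c) + Real.exp (-n * c)) := by
        gcongr
    _ = _ := by ring

theorem BeDStar_le (hζ : IsZeta Φ ζ) (hΦ : ∀ n, ‖Φ n‖ = 1) (r : ℝ) :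
    BeDStar Φ r ≤ ⨆ (a : ℝ) (_ : infHalf ζ a + ((a / 2 : ℝ) : EReal) ≤ r),
      ((a - r : ℝ) : EReal) := by
  refine iSup₂_le fun D hD => EReal.ge_of_forall_gt_iff_ge.mp fun R hR => ?_
  refine le_iSup₂_of_le (R + r) (infHalf_add_le_of_limsup_le hζ hΦ hD hR) ?_
  rw [add_sub_cancel_right]

theorem BePStar_le (hζ : IsZeta Φ ζ) (hΦ : ∀ n, ‖Φ n‖ = 1) (r : ℝ) :
    BePStar Φ r ≤ ⨆ (a : ℝ) (_ : ζ a ≤ r), ((a : EReal) - ζ a) := by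
  refine iSup₂_le fun I hI => EReal.ge_of_forall_gt_iff_ge.mp fun R hR => ?_
  by_contra! hlt
  obtain ⟨b, hb1, hb2⟩ := EReal.lt_iff_exists_real_btwn.mp hlt
  have hbR : b < R := by exact_mod_cast hb2
  have hb : ∀ a z : ℝ, ζ a = z → z ≤ r → a - z ≤ b := by
    intro a z hz hzr
    have h1 : (a : EReal) - ζ a ≤ b :=
      (le_iSup₂ (f := fun (a : ℝ) (_ : ζ a ≤ r) => (a : EReal) - ζ a) a
        (by rw [hz]; exact_mod_cast hzr)).trans hb1.le
    rw [hz, ← EReal.coe_sub] at h1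
    exact_mod_cast h1
  set h := (R - b) / 3 with hh
  have hh0 : 0 < h := by simp only [hh]; linarith
  let g : ℕ → ℝ := fun j => -1 + j * h
  have hex : ∃ N, (r : EReal) < ζ (g N) := by
    obtain ⟨N, hN⟩ := exists_nat_gt ((b + r + 1) / h)
    rw [div_lt_iff₀ hh0] at hN
    refine ⟨N, ?_⟩
    by_contra! hle
    obtain ⟨z, hz⟩ := hζ.exists_real hΦ hle
    rw [hz] at hle
    have hzr : z ≤ r := by exact_mod_cast hle
    have := hb _ z hz hzr
    simp only [g] at this
    linarith
  classical
  let N := Nat.find hex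
  obtain ⟨c, hc1, hc2⟩ := EReal.lt_iff_exists_real_btwn.mp (Nat.find_spec hex)
  have hrc : r < c := by exact_mod_cast hc1
  have hz : ∀ j ∈ Finset.range N, ((g j - b - h : ℝ) : EReal) < ζ (g j) := by
    intro j hj
    have hle : ζ (g j) ≤ r := not_lt.mp (Nat.find_min hex (Finset.mem_range.mp hj))
    obtain ⟨z, hz⟩ := hζ.exists_real hΦ hle
    have h1 := hb _ z hz (by rw [hz] at hle; exact_mod_cast hle)
    rw [hz, EReal.coe_lt_coe_iff]
    linarith
  have hT := (eventually_all_finset (Finset.range N)).mpr fun j hj => hζ.eventually_le (hz j hj)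
  refine not_eventually_le_const_mul_exp (C := 2) hrc hI ?_
  filter_upwards [hT, hζ.eventually_le hc2,
    eventually_le_of_lt_rate (fun n => (I n).target_spec.1) hR,
    eventually_exp_le (1 / (2 * (N + 1))) (by positivity) hh0,
    eventually_gt_atTop 0] with n hn1 hn2 hn3 hn4 hn0
  have hn' : (0 : ℝ) < n := by exact_mod_cast hn0
  have hgrid := succProb_mul_le_grid (hΦ n) (I n) (antitone_grid n (-1) hh0.le)
    (fun j => Real.exp_pos _) (Real.one_lt_exp_iff.mpr (by push_cast; nlinarith)) N
  have hterm : ∀ j ∈ Finset.range N,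
      (specMass (reduced (Φ n)) (Set.Iio (Real.exp (-n * g j)))).toReal /
        Real.exp (-n * g (j + 1)) ≤ Real.exp (-n * -(b + 2 * h)) := by
    intro j hj
    calc _ ≤ Real.exp (-n * (g j - b - h)) / Real.exp (-n * g (j + 1)) := by
          gcongr
          exact ENNReal.toReal_le_of_le_ofReal (Real.exp_pos _).le (hn1 j hj)
      _ = _ := by
          rw [← Real.exp_sub]
          congr 1
          simp only [g]
          push_cast
          ring
  have hsum := Finset.sum_le_card_nsmul _ _ _ hterm
  rw [Finset.card_range, nsmul_eq_mul] at hsum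
  have hratio : (∑ j ∈ Finset.range N,
      (specMass (reduced (Φ n)) (Set.Iio (Real.exp (-n * g j)))).toReal /
        Real.exp (-n * g (j + 1))) / (I n).size ≤ 1 / 2 := by
    calc _ ≤ (N * Real.exp (-n * -(b + 2 * h))) / Real.exp (-n * -R) := by gcongr
      _ = N * Real.exp (-n * h) := by
          rw [mul_div_assoc, ← Real.exp_sub]
          congr 2
          simp only [hh]
          ring
      _ ≤ (N + 1) * (1 / (2 * (N + 1))) := by
          gcongr
          linarith
      _ = 1 / 2 := by field_simp
  have h1 : (I n).succProb * ENNReal.ofReal (1 / 2) ≤ ENNReal.ofReal (Real.exp (-n * c)) := by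
    refine le_trans ?_ (hgrid.trans hn2)
    gcongr
    simp only [g] at hratio
    linarith
  calc (I n).succProb = (I n).succProb * ENNReal.ofReal (1 / 2) * ENNReal.ofReal 2 := by
        rw [mul_assoc, ← ENNReal.ofReal_mul (by norm_num)]
        norm_num
    _ ≤ ENNReal.ofReal (Real.exp (-n * c)) * ENNReal.ofReal 2 := by gcongr
    _ = _ := by rw [← ENNReal.ofReal_mul (Real.exp_pos _).le, mul_comm]

end StrongConverse

section StrongDirect

variable {ι κ : ℕ → Type} {Φ : ∀ n, Sys (ι n × κ n)} {ζ : ℝ → EReal}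

theorem IsZeta.eventually_exp_le_toReal (hζ : IsZeta Φ ζ) (hΦ : ∀ n, ‖Φ n‖ = 1) {a c : ℝ}
    (h : ζ a < c) : ∀ᶠ n : ℕ in atTop, Real.exp (-n * c) ≤
      (specMass (reduced (Φ n)) (Set.Iio (Real.exp (-n * a)))).toReal := by
  filter_upwards [hζ.eventually_ge h] with n hn
  exact (ENNReal.ofReal_le_iff_le_toReal (specMass_ne_top (hΦ n) _)).mp hn

theorem le_BePStar (hζ : IsZeta Φ ζ) (hΦ : ∀ n, ‖Φ n‖ = 1) {a r : ℝ} (h : ζ a ≤ r) :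
    (a : EReal) - ζ a ≤ BePStar Φ r := by
  obtain ⟨z, hz⟩ := hζ.exists_real hΦ h
  have hzr : z ≤ r := by rw [hz] at h; exact_mod_cast h
  rw [hz, ← EReal.coe_sub]
  set T : ℕ → ℝ := fun n => (specMass (reduced (Φ n)) (Set.Iio (Real.exp (-n * a)))).toReal
  have hT : ∀ c > z, ∀ᶠ n : ℕ in atTop, Real.exp (-n * c) ≤ T n := fun c hc =>
    hζ.eventually_exp_le_toReal hΦ (by rw [hz]; exact_mod_cast hc)
  obtain ⟨I, hI⟩ := exists_pflec_seq hΦ (x := fun n => Real.exp (-n * a))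
    (fun n => Real.exp_pos _) (S := fun n => Set.Iio (Real.exp (-n * a)))
    (fun n => Set.Iio_subset_Iic_self) fun n => T n / 2
  have hev : ∀ᶠ n : ℕ in atTop, T n / 2 / (2 * Real.exp (-n * a)) ≤ (I n).size ∧
      ENNReal.ofReal (T n / 2) ≤ (I n).succProb := by
    filter_upwards [hT (z + 1) (by linarith)] with n hn
    have h0 : 0 < T n := (Real.exp_pos _).trans_le hn
    refine hI n (by positivity) ?_
    rw [ENNReal.ofReal_lt_iff_lt_toReal (by positivity) (specMass_ne_top (hΦ n) _)]
    exact half_lt_self h0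
  refine le_iSup₂_of_le I (limsup_expo_le_iff.mpr fun r' hr' => ?_)
    (le_rate_of_const_mul (fun n => (I n).target_spec.1) (C := 1 / 4) (by norm_num) fun R hR => ?_)
  · obtain ⟨c, hc1, hc2⟩ := exists_between (hzr.trans_lt hr')
    filter_upwards [hev, hT c hc1, eventually_const_mul_exp_le 2 hc2] with n h1 h2 h3
    exact le_trans (ENNReal.ofReal_le_ofReal (by linarith)) h1.2
  · filter_upwards [hev, hT (a - R) (by linarith)] with n h1 h2
    refine le_trans ?_ h1.1
    rw [le_div_iff₀ (by positivity)]
    have h3 : Real.exp (-n * -R) * Real.exp (-n * a) = Real.exp (-n * (a - R)) := by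
      rw [← Real.exp_add]
      congr 1
      ring
    linarith

theorem le_BeDStar_of_zeta (hζ : IsZeta Φ ζ) (hΦ : ∀ n, ‖Φ n‖ = 1) {a z r R : ℝ}
    (hz : ζ a = z) (hzr : z ≤ r) (hR : 2 * z - a + R ≤ r) : (R : EReal) ≤ BeDStar Φ r := by
  set T : ℕ → ℝ := fun n => (specMass (reduced (Φ n)) (Set.Iio (Real.exp (-n * a)))).toReal
  have hT : ∀ c > z, ∀ᶠ n : ℕ in atTop, Real.exp (-n * c) ≤ T n := fun c hc =>
    hζ.eventually_exp_le_toReal hΦ (by rw [hz]; exact_mod_cast hc)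
  let L : ℕ → ℕ := fun n => ⌈Real.exp (-n * -R)⌉₊
  have hL : ∀ n, 0 < L n := fun n => Nat.ceil_pos.mpr (Real.exp_pos _)
  have hex : ∀ n, ∃ D : DFLEC (ι n) (κ n), D.size = L n ∧ (0 < T n →
      (ENNReal.ofReal (T n / 2) ≤ D.fidelity (Φ n) ∨ 1 < L n ∧
        ENNReal.ofReal ((T n / 2) ^ 2 / (2 * Real.exp (-n * a) * L n)) ≤ D.fidelity (Φ n))) := by
    intro n
    by_cases h0 : 0 < T n
    · obtain ⟨D, hD, hF⟩ := exists_dflec_of_lt_specMass (Real.exp_pos (-n * a)) (half_pos h0).le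
        (Set.Iio_subset_Iic_self) (by
          rw [ENNReal.ofReal_lt_iff_lt_toReal (half_pos h0).le (specMass_ne_top (hΦ n) _)]
          exact half_lt_self h0) (hL n)
      exact ⟨D, hD, fun _ => hF⟩
    · obtain ⟨I, hI⟩ := exists_pflec_size (hΦ n) (hL n)
      exact ⟨I.toDFLEC, hI, fun h => absurd h h0⟩
  choose D hD hF using hex
  refine le_iSup₂_of_le D (limsup_expo_le_iff.mpr fun r' hr' => ?_)
    (le_rate (fun n => (D n).target_spec.1) fun R' hR' => Eventually.of_forall fun n => ?_)
  · have hd : 0 < (r' - r) / 4 := by linarith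
    filter_upwards [hT (z + (r' - r) / 4) (by linarith),
      eventually_const_mul_exp_le 2 (a := r') (b := z + (r' - r) / 4) (by linarith),
      eventually_const_mul_exp_le 16 (a := r') (b := r + (r' - r) / 2) (by linarith)]
      with n h1 h2 h3
    have h0 : 0 < T n := (Real.exp_pos _).trans_le h1
    rcases hF n h0 with h | ⟨h4, h⟩
    · exact le_trans (ENNReal.ofReal_le_ofReal (by linarith)) h
    refine le_trans (ENNReal.ofReal_le_ofReal ?_) h
    have hL1 : 1 < Real.exp (-n * -R) := by
      by_contra! hle
      exact absurd (Nat.ceil_le.mpr (by exact_mod_cast hle) : L n ≤ 1) (not_le.mpr h4)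
    have hL2 : (L n : ℝ) ≤ 2 * Real.exp (-n * -R) := by
      have := Nat.ceil_lt_add_one (Real.exp_pos (-n * -R)).le
      simp only [L]
      linarith
    have hL0 : (0 : ℝ) < L n := by exact_mod_cast hL n
    calc Real.exp (-n * r') ≤ Real.exp (-n * (r + (r' - r) / 2)) / 16 := by linarith
      _ ≤ Real.exp (-n * (2 * z - a + R + (r' - r) / 2)) / 16 := by
          gcongr ?_ / 16
          refine Real.exp_le_exp.mpr ?_
          rw [neg_mul, neg_mul, neg_le_neg_iff]
          gcongr
      _ = (Real.exp (-n * (z + (r' - r) / 4)) / 2) ^ 2 /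
          (2 * Real.exp (-n * a) * (2 * Real.exp (-n * -R))) := by
          have h5 : Real.exp (-n * (2 * z - a + R + (r' - r) / 2)) =
              Real.exp (-n * (z + (r' - r) / 4)) ^ 2 /
                (Real.exp (-n * a) * Real.exp (-n * -R)) := by
            rw [sq, ← Real.exp_add, ← Real.exp_add, ← Real.exp_sub]
            congr 1
            ring
          rw [h5]
          field_simp
          norm_num
      _ ≤ _ := by gcongr
  · rw [hD]
    refine le_trans (Real.exp_le_exp.mpr ?_) (Nat.le_ceil _)
    rw [neg_mul_neg, neg_mul_neg]
    gcongr

theorem IsZeta.exists_near_infHalf (hζ : IsZeta Φ ζ) (hΦ : ∀ n, ‖Φ n‖ = 1) {a η : ℝ}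
    (hη : infHalf ζ a = η) {δ : ℝ} (hδ : 0 < δ) :
    ∃ a' z : ℝ, ζ a' = z ∧ z ≤ η + a / 2 ∧ z ≤ η + δ + a' / 2 := by
  have hnear : ∀ d > 0, ∃ a' ≤ a, ∃ z : ℝ, ζ a' = z ∧ z ≤ η + d + a' / 2 := by
    intro d hd
    have h1 : infHalf ζ a < ((η + d : ℝ) : EReal) := by
      rw [hη, EReal.coe_lt_coe_iff]; linarith
    simp only [infHalf, iInf_lt_iff] at h1
    obtain ⟨a', ha', h2⟩ := h1
    have h3 : ζ a' ≤ ((η + d + a' / 2 : ℝ) : EReal) := by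
      have := (EReal.sub_lt_iff (Or.inl (EReal.coe_ne_bot _)) (Or.inl (EReal.coe_ne_top _))).mp h2
      rw [← EReal.coe_add] at this
      exact this.le
    obtain ⟨z, hz⟩ := hζ.exists_real hΦ h3
    rw [hz] at h3
    exact ⟨a', ha', z, hz, by exact_mod_cast h3⟩
  by_cases hfar : ∃ d ∈ Set.Ioc 0 δ, ∃ a' z : ℝ, a' ≤ a - 2 * d ∧ ζ a' = z ∧
      z ≤ η + d + a' / 2
  · obtain ⟨d, hd, a', z, h1, h2, h3⟩ := hfar
    exact ⟨a', z, h2, by linarith, by linarith [hd.2]⟩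
  · push Not at hfar
    have hle : ∀ d ∈ Set.Ioc 0 δ, ζ (a - 2 * δ) ≤ ((η + d + a / 2 : ℝ) : EReal) := by
      intro d hd
      obtain ⟨a', ha', z, hz, hz'⟩ := hnear d hd.1
      have h1 : a - 2 * d < a' := by
        by_contra! h
        exact absurd hz' (not_le.mpr (hfar d hd a' z h hz))
      refine (hζ.mono (by linarith [hd.2] : a - 2 * δ ≤ a')).trans ?_
      rw [hz]
      exact EReal.coe_le_coe_iff.mpr (by linarith)
    obtain ⟨z, hz⟩ := hζ.exists_real hΦ (hle δ ⟨hδ, le_rfl⟩)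
    have hz' : z ≤ η + a / 2 := by
      refine le_of_forall_pos_le_add fun d hd => ?_
      have h1 := hle (min d δ) ⟨lt_min hd hδ, min_le_right _ _⟩
      rw [hz, EReal.coe_le_coe_iff] at h1
      linarith [min_le_left d δ]
    exact ⟨a - 2 * δ, z, hz, hz', by linarith⟩

theorem IsZeta.exists_real_infHalf (hζ : IsZeta Φ ζ) (hΦ : ∀ n, ‖Φ n‖ = 1) {a r : ℝ}
    (h : infHalf ζ a + ((a / 2 : ℝ) : EReal) ≤ r) :
    ∃ η : ℝ, infHalf ζ a = η ∧ η + a / 2 ≤ r := by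
  have h1 : ((-(a / 2) : ℝ) : EReal) ≤ infHalf ζ a := by
    refine le_iInf₂ fun a' ha' => ?_
    calc ((-(a / 2) : ℝ) : EReal) ≤ 0 - ((a' / 2 : ℝ) : EReal) := by
          rw [zero_sub, ← EReal.coe_neg, EReal.coe_le_coe_iff]
          linarith
      _ ≤ _ := EReal.sub_le_sub (hζ.nonneg hΦ a') le_rfl
  generalize infHalf ζ a = x at h h1
  induction x using EReal.rec with
  | bot => exact absurd h1 (not_le.mpr (EReal.bot_lt_coe _))
  | top => simp at h
  | coe x => exact ⟨x, rfl, by exact_mod_cast h⟩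

theorem sub_infHalf_le_BeDStar (hζ : IsZeta Φ ζ) (hΦ : ∀ n, ‖Φ n‖ = 1) {a r : ℝ}
    (h : infHalf ζ a + ((a / 2 : ℝ) : EReal) ≤ r) :
    ((a / 2 : ℝ) : EReal) - infHalf ζ a ≤ BeDStar Φ r := by
  obtain ⟨η, hη, hr⟩ := hζ.exists_real_infHalf hΦ h
  rw [hη, ← EReal.coe_sub]
  refine EReal.ge_of_forall_gt_iff_ge.mp fun R hR => ?_
  have hR' : R < a / 2 - η := by exact_mod_cast hR
  obtain ⟨a', z, hz, h1, h2⟩ := hζ.exists_near_infHalf hΦ hη (δ := (a / 2 - η - R) / 2)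
    (by linarith)
  exact le_BeDStar_of_zeta hζ hΦ hz (h1.trans hr) (by linarith)

theorem iSup_sub_le_iSup_sub_infHalf (hζ : IsZeta Φ ζ) (hΦ : ∀ n, ‖Φ n‖ = 1) (r : ℝ) :
    (⨆ (a : ℝ) (_ : infHalf ζ a + ((a / 2 : ℝ) : EReal) ≤ r), ((a - r : ℝ) : EReal)) ≤
      ⨆ (a : ℝ) (_ : infHalf ζ a + ((a / 2 : ℝ) : EReal) ≤ r),
        (((a / 2 : ℝ) : EReal) - infHalf ζ a) := by
  refine iSup₂_mono fun a h => ?_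
  obtain ⟨η, hη, hr⟩ := hζ.exists_real_infHalf hΦ h
  rw [hη, ← EReal.coe_sub, EReal.coe_le_coe_iff]
  linarith

end StrongDirect

end EntConc

end

theorem theorem1 {ι κ : ℕ → Type} (Φ : ∀ n, EntConc.Sys (ι n × κ n)) (hΦ : ∀ n, ‖Φ n‖ = 1) :
    (∀ ε : ℝ, 0 ≤ ε → ε ≤ 1 →
      EntConc.BD Φ ε = EntConc.BP Φ ε ∧
      EntConc.BP Φ ε = ⨆ (R : ℝ) (_ : EntConc.K Φ R ≤ ENNReal.ofReal ε), (R : EReal)) ∧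
    (∀ r : ℝ,
      EntConc.BeD Φ r = EntConc.BeP Φ r ∧
      EntConc.BeP Φ r = ⨆ (R : ℝ) (_ : (r : EReal) ≤ EntConc.zetaC Φ R), (R : EReal)) ∧
    (∀ ζ : ℝ → EReal, EntConc.IsZeta Φ ζ → (∃ a : ℝ, ζ a ≤ EntConc.zetaC Φ a) →
      ∀ r : ℝ,
        EntConc.BeDStar Φ r =
          (⨆ (a : ℝ) (_ : EntConc.infHalf ζ a + ((a / 2 : ℝ) : EReal) ≤ r),
            ((a - r : ℝ) : EReal)) ∧
        EntConc.BeDStar Φ r =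
          (⨆ (a : ℝ) (_ : EntConc.infHalf ζ a + ((a / 2 : ℝ) : EReal) ≤ r),
            (((a / 2 : ℝ) : EReal) - EntConc.infHalf ζ a)) ∧
        EntConc.BePStar Φ r = ⨆ (a : ℝ) (_ : ζ a ≤ r), ((a : EReal) - ζ a)) := by
  refine ⟨fun ε h0 h1 => ?_, fun r => ?_, fun ζ hζ _ r => ?_⟩
  · have hP : (⨆ (R : ℝ) (_ : EntConc.K Φ R ≤ ENNReal.ofReal ε), (R : EReal)) ≤
        EntConc.BP Φ ε := iSup₂_le fun R hR => EntConc.le_BP hΦ h0 h1 hR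
    have hPD := EntConc.BP_le_BD hΦ h0
    have hD := EntConc.BD_le hΦ h0
    exact ⟨(hD.trans hP).antisymm hPD, (hPD.trans hD).antisymm hP⟩
  · have hP : (⨆ (R : ℝ) (_ : (r : EReal) ≤ EntConc.zetaC Φ R), (R : EReal)) ≤
        EntConc.BeP Φ r := iSup₂_le fun R hR => EntConc.le_BeP hΦ hR
    have hPD := EntConc.BeP_le_BeD hΦ r
    have hD := EntConc.BeD_le hΦ r
    exact ⟨(hD.trans hP).antisymm hPD, (hPD.trans hD).antisymm hP⟩
  · have h12 := EntConc.iSup_sub_le_iSup_sub_infHalf hζ hΦ r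
    have hD : (⨆ (a : ℝ) (_ : EntConc.infHalf ζ a + ((a / 2 : ℝ) : EReal) ≤ r),
        (((a / 2 : ℝ) : EReal) - EntConc.infHalf ζ a)) ≤ EntConc.BeDStar Φ r :=
      iSup₂_le fun a h => EntConc.sub_infHalf_le_BeDStar hζ hΦ h
    have hle := EntConc.BeDStar_le hζ hΦ r
    exact ⟨hle.antisymm (h12.trans hD), (hle.trans h12).antisymm hD,
      (EntConc.BePStar_le hζ hΦ r).antisymm (iSup₂_le fun a h => EntConc.le_BePStar hζ hΦ h)⟩
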